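/- Let $\ell\ge 3$ and let $p(z)=z^{\ell}+b_{\ell-1}z^{\ell-1}+\dots+b_1z+b_0$ have complex coefficients. Zeros are counted with multiplicity and $\bar O(c;r)$ denotes the closed disc with centre $c$ and radius $r$. Put $m=\lceil \ell/2\rceil$, $n=2m$; if $\ell$ is even let $a_j=b_j$ $(0\le j\le n-1)$, and if $\ell$ is odd let $a_0=0$ and $a_j=b_{j-1}$ $(1\le j\le n-1)$. Define $$A_0=\begin{pmatrix}-a_0&a_{n-1}a_0\\-a_1&a_{n-1}a_1-a_0\end{pmatrix},\qquad A_j=\begin{pmatrix}-a_{2j}&a_{n-1}a_{2j}-a_{2j-1}\\-a_{2j+1}&a_{n-1}a_{2j+1}-a_{2j}\end{pmatrix}\quad(1\le j\le m-1).$$ Let $S$ be any nonsingular $2\times2$ complex matrix such that $S^{-1}A_{m-1}S=\begin{pmatrix}\alpha&\gamma\\0&\beta\end{pmatrix}$ with $\alpha,\beta,\gamma\in\mathbb C$, and define $v,w\in\mathbb C^{n-2}$ by $\begin{pmatrix}v_{2j}&w_{2j}\\v_{2j+1}&w_{2j+1}\end{pmatrix}=S^{-1}A_jS$ for $0\le j\le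 m-2$. For $x>0$ let $$\rho_1(x)=\sum_{k=0}^{n-3}\frac{|v_k|}{x^{n-2-k}},\qquad \rho_2(x)=\frac{|\gamma|}{x}+\sum_{k=0}^{n-3}\frac{|w_k|}{x^{n-1-k}},$$ $$\chi_1(x)=x^n-|\alpha|x^{n-2}+\sum_{k=0}^{n-3}|v_k|x^k,\qquad \chi_2(x)=x^{n+1}-|\beta|x^{n-1}+|\gamma|x^{n-2}+\sum_{k=0}^{n-3}|w_k|x^k,$$ $$\sigma_1(x)=\sum_{j=0}^{m-2}\frac{|v_{2j+1}|+|v_{2j}|}{x^{m-1-j}},\qquad \sigma_2(x)=|\gamma|+\sum_{j=0}^{m-2}\frac{|w_{2j+1}|+|w_{2j}|}{x^{m-1-j}},$$ $$\omega_1(x)=x^m-|\alpha|x^{m-1}+\sum_{j=0}^{m-2}(|v_{2j+1}|+|v_{2j}|)x^j,\qquad \omega_2(x)=x^m-(|\beta|-|\gamma|)x^{m-1}+\sum_{j=0}^{m-2}(|w_{2j+1}|+|w_{2j}|)x^j,$$ and put $O_1(x)=\bar O(0;x^2)$, $O_2(x)=\bar O(\alpha;\rho_1(x))$, $O_3(x)=\bar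 O(\beta;\rho_2(x))$, $O_1'(x)=\bar O(0;x)$, $O_2'(x)=\bar O(\alpha;\sigma_1(x))$, $O_3'(x)=\bar O(\beta;\sigma_2(x))$. If $\chi_1$ has exactly two positive roots, counted with multiplicity, $t_1\le t_2$, set $I_1=[t_1,t_2]$; otherwise $I_1=\emptyset$. In the same way define $I_2=[u_1,u_2]$ from $\chi_2$, $J_1=[\tilde t_1,\tilde t_2]$ from $\omega_1$, and $J_2=[\tilde u_1,\tilde u_2]$ from $\omega_2$. Then the following holds. **(a1)** If $I_1\cap I_2\ne\emptyset$, set $\mu_1=\max\{t_1,u_1\}$ and $\mu_2=\min\{t_2,u_2\}$. Then $\ell-2$ of the zeros of $p$ lie in $\bar O(0;\mu_1)$ and the squares of the two remaining zeros lie in $O_2(\mu_2)\cup O_3(\mu_2)$; moreover $p$ has no zero $\zeta$ with $\mu_1<|\zeta|<\left(\min\{|\alpha|-\rho_1(\mu_2),|\beta|-\rho_2(\mu_2)\}\right)^{1/2}$. If in addition $|\alpha-\beta|>\rho_1(\mu_2)+\rho_2(\mu_2)$, then of the squares of these two remaining zeros one lies in $O_2(\mu_2)$ and the other in $O_3(\mu_2)$.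 **(a2)** Suppose $I_1\cap I_2=\emptyset$. - If $I_1\neq\emptyset$ and $|\alpha-\beta|>\rho_1(t_2)+\rho_2(t_2)$, then the squares of $\ell-1$ of the zeros of $p$ lie in $O_1(t_2)\cup O_3(t_2)$ and the square of the remaining zero lies in $O_2(t_2)$. - If $I_2\neq\emptyset$ and $|\alpha-\beta|>\rho_1(u_2)+\rho_2(u_2)$, then the squares of $\ell-1$ of the zeros of $p$ lie in $O_1(u_2)\cup O_2(u_2)$ and the square of the remaining zero lies in $O_3(u_2)$. **(b1)** If $J_1\cap J_2\ne\emptyset$, set $\tilde\mu_1=\max\{\tilde t_1,\tilde u_1\}$ and $\tilde\mu_2=\min\{\tilde t_2,\tilde u_2\}$. Then $\ell-2$ of the zeros of $p$ lie in $\bar O(0;\sqrt{\tilde\mu_1})$ and the squares of the two remaining zeros lie in $O_2'(\tilde\mu_2)\cup O_3'(\tilde\mu_2)$; moreover $p$ has no zero $\zeta$ with $\sqrt{\tilde\mu_1}<|\zeta|<\left(\min\{|\alpha|-\sigma_1(\tilde\mu_2),|\beta|-\sigma_2(\tilde\mu_2)\}\right)^{1/2}$. If in addition $|\alpha-\beta|>\sigma_1(\tilde\mu_2)+\sigma_2(\tilde\mu_2)$,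 then of the squares of these two remaining zeros one lies in $O_2'(\tilde\mu_2)$ and the other in $O_3'(\tilde\mu_2)$. **(b2)** Suppose $J_1\cap J_2=\emptyset$ or $I_1\cap I_2=\emptyset$. - If $J_1\neq\emptyset$ and $|\alpha-\beta|>\sigma_1(\tilde t_2)+\sigma_2(\tilde t_2)$, then the squares of $\ell-1$ of the zeros of $p$ lie in $O_1'(\tilde t_2)\cup O_3'(\tilde t_2)$ and the square of the remaining zero lies in $O_2'(\tilde t_2)$. - If $J_2\neq\emptyset$ and $|\alpha-\beta|>\sigma_1(\tilde u_2)+\sigma_2(\tilde u_2)$, then the squares of $\ell-1$ of the zeros of $p$ lie in $O_1'(\tilde u_2)\cup O_2'(\tilde u_2)$ and the square of the remaining zero lies in $O_3'(\tilde u_2)$. -/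

import Mathlib

open Polynomial

noncomputable section

namespace PelletSquared

/-- The monic polynomial `z ^ ℓ + b (ℓ-1) z ^ (ℓ-1) + ⋯ + b 1 z + b 0`. -/
def monicPoly (ℓ : ℕ) (b : ℕ → ℂ) : ℂ[X] :=
  X ^ ℓ + ∑ j ∈ Finset.range ℓ, C (b j) * X ^ j

/-- `m = ⌈ℓ / 2⌉`. -/
def halfDeg (ℓ : ℕ) : ℕ := (ℓ + 1) / 2

/-- The numbers `a_j` (used for `j ≤ n - 1 = 2 ⌈ℓ / 2⌉ - 1` only): `a_j = b_j` when `ℓ` is even;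
`a_0 = 0` and `a_j = b_{j-1}` for `j ≥ 1` when `ℓ` is odd. -/
def evenCoeff (ℓ : ℕ) (b : ℕ → ℂ) (j : ℕ) : ℂ :=
  if Even ℓ then b j else if j = 0 then 0 else b (j - 1)

/-- The `2 × 2` blocks `A_j`, `0 ≤ j ≤ m - 1`, for coefficients `a_0, …, a_{n-1}`; in `A_0` the
term `a_{2j-1}` is absent. -/
def blockA (n : ℕ) (a : ℕ → ℂ) (j : ℕ) : Matrix (Fin 2) (Fin 2) ℂ :=
  !![-a (2 * j), a (n - 1) * a (2 * j) - (if j = 0 then 0 else a (2 * j - 1));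
     -a (2 * j + 1), a (n - 1) * a (2 * j + 1) - a (2 * j)]

/-- `ρ₁(x) = |v_{n-3}| / x + |v_{n-4}| / x² + ⋯ + |v_0| / x ^ (n-2)`. -/
def rho1 (n : ℕ) (v : ℕ → ℂ) (x : ℝ) : ℝ :=
  ∑ k ∈ Finset.range (n - 2), ‖v k‖ / x ^ (n - 2 - k)

/-- `ρ₂(x) = |γ| / x + |w_{n-3}| / x² + |w_{n-4}| / x³ + ⋯ + |w_0| / x ^ (n-1)`. -/
def rho2 (n : ℕ) (γ : ℂ) (w : ℕ → ℂ) (x : ℝ) : ℝ :=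
  ‖γ‖ / x + ∑ k ∈ Finset.range (n - 2), ‖w k‖ / x ^ (n - 1 - k)

/-- `χ₁(x) = x ^ n - |α| x ^ (n-2) + |v_{n-3}| x ^ (n-3) + ⋯ + |v_1| x + |v_0|`. -/
def chi1 (n : ℕ) (α : ℂ) (v : ℕ → ℂ) : ℝ[X] :=
  X ^ n - C ‖α‖ * X ^ (n - 2) + ∑ k ∈ Finset.range (n - 2), C ‖v k‖ * X ^ k

/-- `χ₂(x) = x ^ (n+1) - |β| x ^ (n-1) + |γ| x ^ (n-2) + |w_{n-3}| x ^ (n-3) + ⋯ + |w_0|`. -/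
def chi2 (n : ℕ) (β γ : ℂ) (w : ℕ → ℂ) : ℝ[X] :=
  X ^ (n + 1) - C ‖β‖ * X ^ (n - 1) + C ‖γ‖ * X ^ (n - 2)
    + ∑ k ∈ Finset.range (n - 2), C ‖w k‖ * X ^ k

/-- `σ₁(x) = (|v_{n-3}| + |v_{n-4}|) / x + ⋯ + (|v_1| + |v_0|) / x ^ (m-1)`, where `n = 2 m`. -/
def sigma1 (m : ℕ) (v : ℕ → ℂ) (x : ℝ) : ℝ :=
  ∑ j ∈ Finset.range (m - 1), (‖v (2 * j + 1)‖ + ‖v (2 * j)‖) / x ^ (m - 1 - j)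

/-- `σ₂(x) = |γ| + (|w_{n-3}| + |w_{n-4}|) / x + ⋯ + (|w_1| + |w_0|) / x ^ (m-1)`. -/
def sigma2 (m : ℕ) (γ : ℂ) (w : ℕ → ℂ) (x : ℝ) : ℝ :=
  ‖γ‖ + ∑ j ∈ Finset.range (m - 1), (‖w (2 * j + 1)‖ + ‖w (2 * j)‖) / x ^ (m - 1 - j)

/-- `ω₁(x) = x ^ m - |α| x ^ (m-1) + (|v_{n-3}| + |v_{n-4}|) x ^ (m-2) + ⋯ + (|v_1| + |v_0|)`. -/
def omega1 (m : ℕ) (α : ℂ) (v : ℕ → ℂ) : ℝ[X] :=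
  X ^ m - C ‖α‖ * X ^ (m - 1)
    + ∑ j ∈ Finset.range (m - 1), C (‖v (2 * j + 1)‖ + ‖v (2 * j)‖) * X ^ j

/-- `ω₂(x) = x ^ m - (|β| - |γ|) x ^ (m-1) + (|w_{n-3}| + |w_{n-4}|) x ^ (m-2) + ⋯
+ (|w_1| + |w_0|)`. -/
def omega2 (m : ℕ) (β γ : ℂ) (w : ℕ → ℂ) : ℝ[X] :=
  X ^ m - C (‖β‖ - ‖γ‖) * X ^ (m - 1)
    + ∑ j ∈ Finset.range (m - 1), C (‖w (2 * j + 1)‖ + ‖w (2 * j)‖) * X ^ j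

/-- The positive roots of `q`, counted with multiplicity, are exactly `s ≤ t`. -/
def HasPosRoots (q : ℝ[X]) (s t : ℝ) : Prop :=
  s ≤ t ∧ q.roots.filter (fun x => 0 < x) = {s, t}

/-- The interval `[s, t]` if `q` has the two positive roots `s ≤ t`, and `∅` otherwise. -/
def posRootInterval (q : ℝ[X]) : Set ℝ :=
  {x | ∃ s t : ℝ, HasPosRoots q s t ∧ x ∈ Set.Icc s t}

end PelletSquared

end

noncomputable section

namespace PelletSquared

/-! ### Enumerations of multisets by finite types -/

/-! If `ℓ` is odd, multiply `p` by `X`, so that the degree is `n = 2 * m`. The square of the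
companion matrix has the squares of the zeros as eigenvalues. Cut into `2 × 2` blocks, it is a block
companion matrix with last block column `A_j`, and conjugation by `1 ⊗ S` makes its last diagonal
block triangular.

Conjugating further by a positive diagonal matrix with parameter `x` gives column Gershgorin discs
with only three centres: `0`, `α` and `β`. Weights `x ^ k` on the single indices give the radii `x ^
2`, `ρ₁ x`, `ρ₂ x`; weights `x ^ j` constant on blocks give `x`, `σ₁ x`, `σ₂ x`. Up to a power of
`x`, `χ₁ x` is `x ^ 2 - ‖α‖ + ρ₁ x`, so `χ₁ x ≤ 0` says that the discs about `0` and `α` do not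
overlap, and this holds between the two positive roots; likewise for `χ₂`, `ω₁`, `ω₂`.

A form of Gershgorin's theorem that counts eigenvalues and lets discs touch
(`exists_charpoly_eq_prod_of_separated`) then locates the zeros. When the intervals meet, the
scalings at both ends of the intersection are combined: the left end bounds the small zeros, the
right end locates the other two, and `norm_sq_le_of_splittings` shows that both ends single out the
same zeros. -/

theorem exists_perm_of_map_univ_eq {ι X : Type*} [Fintype ι] {f g : ι → X}
    (h : Finset.univ.val.map f = Finset.univ.val.map g) :
    ∃ σ : Equiv.Perm ι, ∀ i, g (σ i) = f i := by
  classical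
  -- Equal multisets have fibres of equal size, and bijections between the fibres glue to a
  -- permutation.
  have hc : ∀ a, Nonempty ({i // f i = a} ≃ {i // g i = a}) := by
    intro a
    refine ⟨Fintype.equivOfCardEq ?_⟩
    have := congrArg (Multiset.count a) h
    rw [Multiset.count_map, Multiset.count_map] at this
    rw [Fintype.card_subtype, Fintype.card_subtype]
    simpa [Finset.card_def, eq_comm] using this
  let e := fun a => (hc a).some
  exact ⟨Equiv.ofFiberEquiv e, fun i => Equiv.ofFiberEquiv_map e i⟩

theorem exists_map_univ_eq {ι X : Type*} [Fintype ι] (s : Multiset X)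
    (h : s.card = Fintype.card ι) : ∃ f : ι → X, Finset.univ.val.map f = s := by
  induction s using Quotient.inductionOn with
  | _ l =>
    have hl : l.length = Fintype.card ι := by simpa using h
    let e : ι ≃ Fin l.length := Fintype.equivFinOfCardEq hl.symm
    refine ⟨fun i => l.get (e i), ?_⟩
    have h1 : (Finset.univ : Finset ι).val.map e = Finset.univ.val := by
      simp
    have h2 : (Finset.univ : Finset ι).val.map (fun i => l.get (e i))
        = ((Finset.univ : Finset ι).val.map e).map l.get := by
      rw [Multiset.map_map]; rfl
    rw [h2, h1, Fin.univ_val_map, List.ofFn_get]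
    rfl

theorem roots_prod_X_sub_C_univ {ι : Type*} [Fintype ι] (r : ι → ℂ) :
    (∏ i, (X - C (r i))).roots = Finset.univ.val.map r := by
  have : ∏ i, (X - C (r i)) = ((Finset.univ.val.map r).map (fun a => X - C a)).prod := by
    rw [Multiset.map_map]; rfl
  rw [this, roots_multiset_prod_X_sub_C]

theorem exists_eq_prod_X_sub_C {ι : Type*} [Fintype ι] {q : ℂ[X]} (hq : q.Monic)
    (hd : q.natDegree = Fintype.card ι) :
    ∃ r : ι → ℂ, q = ∏ i, (X - C (r i)) := by
  have hs := IsAlgClosed.splits q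
  obtain ⟨r, hr⟩ := exists_map_univ_eq (ι := ι) q.roots (by rw [← hd, hs.natDegree_eq_card_roots])
  refine ⟨r, ?_⟩
  have := hs.eq_prod_roots
  rw [hq.leadingCoeff, C_1, one_mul, ← hr, Multiset.map_map] at this
  exact this

/-! ### Gershgorin's theorem with a count of the eigenvalues -/

section Gershgorin

variable {ι : Type*} [Fintype ι] [DecidableEq ι]

/-- Gershgorin's theorem for columns. -/
theorem exists_mem_closedBall_of_isRoot_charpoly {M : Matrix ι ι ℂ} {R : ι → ℝ}
    (hR : ∀ j, ∑ i ∈ Finset.univ.erase j, ‖M i j‖ ≤ R j) {z : ℂ} (hz : M.charpoly.IsRoot z) :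
    ∃ j, z ∈ Metric.closedBall (M j j) (R j) := by
  -- `eigenvalue_mem_ball` concerns rows, hence the passage to the transpose.
  rw [← Matrix.charpoly_transpose, ← Matrix.charpoly_toLin',
    ← Module.End.hasEigenvalue_iff_isRoot_charpoly] at hz
  obtain ⟨j, hj⟩ := eigenvalue_mem_ball hz
  exact ⟨j, Metric.closedBall_subset_closedBall (hR j) hj⟩

/-- The matrix `M` with its off-diagonal entries multiplied by `t`. -/
def scaleOffDiag (M : Matrix ι ι ℂ) (t : ℝ) : Matrix ι ι ℂ :=
  Matrix.of fun i j => if i = j then M i j else t * M i j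

/-- The parameters `t` for which the eigenvalues of `scaleOffDiag M t` can be enumerated so that the
`i`-th one lies in the union of the Gershgorin discs with the label of `f i`. -/
def labelledParams {κ : Type*} (M : Matrix ι ι ℂ) (R : ι → ℝ) (g : ι → κ) (f : ι → ι) : Set ℝ :=
  {t | t ∈ Set.Icc (0 : ℝ) 1 ∧ ∃ r : ι → ℂ, (scaleOffDiag M t).charpoly = ∏ i, (X - C (r i)) ∧
    ∀ i, ∃ j, g j = g (f i) ∧ r i ∈ Metric.closedBall (M j j) (t * R j)}

/-- This plays the role of continuity of the eigenvalues. The pairs of a parameter and an admissible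
enumeration form a closed bounded set, hence a compact one, and its projection to the parameter is
compact. -/
theorem isClosed_labelledParams {κ : Type*} (M : Matrix ι ι ℂ) (R : ι → ℝ) (g : ι → κ)
    (f : ι → ι) : IsClosed (labelledParams M R g f) := by
  -- Every disc with `t ≤ 1` lies in the ball of radius `B` about `0`.
  set B : ℝ := ∑ j, (‖M j j‖ + |R j|) with hB
  let s : Set (ℝ × (ι → ℂ)) := {q | (∀ z, (Matrix.scalar ι z - scaleOffDiag M q.1).det
      = ∏ i, (z - q.2 i)) ∧ ∀ i, ∃ j, g j = g (f i) ∧ ‖q.2 i - M j j‖ ≤ q.1 * R j}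
  have hs : IsClosed s := by
    have h1 : IsClosed {q : ℝ × (ι → ℂ) | ∀ z, (Matrix.scalar ι z - scaleOffDiag M q.1).det
        = ∏ i, (z - q.2 i)} := by
      simp only [Set.ofPred_forall]
      refine isClosed_iInter fun z => isClosed_eq ?_ (by fun_prop)
      refine Continuous.matrix_det (continuous_const.sub ?_)
      refine continuous_pi fun i => continuous_pi fun j => ?_
      by_cases h : i = j
      · simp only [scaleOffDiag, Matrix.of_apply, if_pos h]; fun_prop
      · simp only [scaleOffDiag, Matrix.of_apply, if_neg h]; fun_prop
    have h2 : IsClosed {q : ℝ × (ι → ℂ) | ∀ i, ∃ j, g j = g (f i) ∧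
        ‖q.2 i - M j j‖ ≤ q.1 * R j} := by
      simp only [Set.ofPred_forall, Set.ofPred_exists]
      refine isClosed_iInter fun i => isClosed_iUnion_of_finite fun j => ?_
      by_cases h : g j = g (f i)
      · simp only [h, true_and]
        exact isClosed_le (by fun_prop) (by fun_prop)
      · simp [h]
    exact h1.inter h2
  have hK : IsCompact (Set.Icc (0 : ℝ) 1 ×ˢ
      Set.pi Set.univ fun _ : ι => Metric.closedBall (0 : ℂ) B) :=
    isCompact_Icc.prod (isCompact_univ_pi fun _ => isCompact_closedBall _ _)
  have himg : labelledParams M R g f = Prod.fst '' ((Set.Icc (0 : ℝ) 1 ×ˢ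
      Set.pi Set.univ fun _ : ι => Metric.closedBall (0 : ℂ) B) ∩ s) := by
    ext t
    constructor
    · rintro ⟨ht, r, hr, hd⟩
      refine ⟨(t, r), ⟨⟨ht, fun i _ => ?_⟩, fun z => ?_, fun i => ?_⟩, rfl⟩
      · obtain ⟨j, -, hj⟩ := hd i
        rw [mem_closedBall_iff_norm] at hj
        rw [mem_closedBall_zero_iff]
        have h1 : ‖r i‖ ≤ ‖r i - M j j‖ + ‖M j j‖ := by
          simpa using norm_add_le (r i - M j j) (M j j)
        have h2 : t * R j ≤ |R j| := by
          calc t * R j ≤ |t * R j| := le_abs_self _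
            _ = t * |R j| := by rw [abs_mul, abs_of_nonneg ht.1]
            _ ≤ |R j| := mul_le_of_le_one_left (abs_nonneg _) ht.2
        have h3 : ‖M j j‖ + |R j| ≤ B :=
          Finset.single_le_sum (f := fun j => ‖M j j‖ + |R j|)
            (fun _ _ => by positivity) (Finset.mem_univ j)
        show ‖r i‖ ≤ B
        linarith
      · show (Matrix.scalar ι z - scaleOffDiag M t).det = _
        rw [← Matrix.eval_charpoly, hr, eval_prod]
        simp
      · obtain ⟨j, hj, hj'⟩ := hd i
        exact ⟨j, hj, by rwa [mem_closedBall_iff_norm] at hj'⟩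
    · rintro ⟨⟨t', r⟩, ⟨⟨ht, -⟩, hr, hd⟩, rfl⟩
      refine ⟨ht, r, Polynomial.funext fun z => ?_, fun i => ?_⟩
      · rw [Matrix.eval_charpoly, hr z, eval_prod]
        simp
      · obtain ⟨j, hj, hj'⟩ := hd i
        exact ⟨j, hj, by rwa [mem_closedBall_iff_norm]⟩
  rw [himg]
  exact ((hK.inter_right hs).image continuous_fst).isClosed

/-- **Gershgorin's theorem with multiplicities**: if the column discs carry labels, and discs with
different labels have disjoint interiors and distinct centres, then the eigenvalues can be
enumerated so that the `i`-th one lies in a disc with the label of `i`. -/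
theorem exists_charpoly_eq_prod_of_separated {κ : Type*} (M : Matrix ι ι ℂ) (R : ι → ℝ)
    (hR : ∀ j, ∑ i ∈ Finset.univ.erase j, ‖M i j‖ ≤ R j) (g : ι → κ)
    (hsep : ∀ i j, g i ≠ g j → M i i ≠ M j j ∧ R i + R j ≤ ‖M i i - M j j‖) :
    ∃ r : ι → ℂ, M.charpoly = ∏ i, (X - C (r i)) ∧
      ∀ i, ∃ j, g j = g i ∧ r i ∈ Metric.closedBall (M j j) (R j) := by
  have hR0 : ∀ j, 0 ≤ R j := fun j => (Finset.sum_nonneg fun _ _ => norm_nonneg _).trans (hR j)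
  set A := labelledParams M R g id with hA
  -- `A` collects the parameters with the right number of eigenvalues per label, `B` those admitting
  -- a wrong count. Both are closed, as there are finitely many `f`.
  let F : Set (ι → ι) := {f | ¬ ∃ σ : Equiv.Perm ι, ∀ i, g (f (σ i)) = g i}
  set B := ⋃ f ∈ F, labelledParams M R g f with hB
  have hAc : IsClosed A := isClosed_labelledParams M R g id
  have hBc : IsClosed B :=
    (Set.toFinite F).isClosed_biUnion fun f _ => isClosed_labelledParams M R g f
  have hdiag : ∀ t j, scaleOffDiag M t j j = M j j := fun t j => by simp [scaleOffDiag]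
  have hcover : Set.Icc (0 : ℝ) 1 ⊆ A ∪ B := by
    intro t ht
    obtain ⟨r, hr⟩ := exists_eq_prod_X_sub_C (ι := ι) (scaleOffDiag M t).charpoly_monic
      (scaleOffDiag M t).charpoly_natDegree_eq_dim
    have hroot : ∀ i, ∃ j, r i ∈ Metric.closedBall (M j j) (t * R j) := by
      intro i
      have := exists_mem_closedBall_of_isRoot_charpoly (M := scaleOffDiag M t)
        (R := fun j => t * R j) (z := r i) (fun j => ?_) ?_
      · simpa only [hdiag] using this
      · calc ∑ i ∈ Finset.univ.erase j, ‖scaleOffDiag M t i j‖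
            = ∑ i ∈ Finset.univ.erase j, t * ‖M i j‖ := by
              refine Finset.sum_congr rfl fun i hi => ?_
              simp [scaleOffDiag, Finset.ne_of_mem_erase hi, abs_of_nonneg ht.1]
          _ = t * ∑ i ∈ Finset.univ.erase j, ‖M i j‖ := by rw [Finset.mul_sum]
          _ ≤ t * R j := mul_le_mul_of_nonneg_left (hR j) ht.1
      · rw [hr, IsRoot.def, eval_prod]
        exact Finset.prod_eq_zero (Finset.mem_univ i) (by simp)
    choose f hf using hroot
    by_cases hfF : f ∈ F
    · exact Or.inr (Set.mem_biUnion hfF ⟨ht, r, hr, fun i => ⟨f i, rfl, hf i⟩⟩)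
    · obtain ⟨σ, hσ⟩ := not_not.mp hfF
      refine Or.inl ⟨ht, fun i => r (σ i), ?_, fun i => ⟨f (σ i), hσ i, hf (σ i)⟩⟩
      rw [hr]
      exact (Equiv.prod_comp σ fun i => X - C (r i)).symm
  -- For `t < 1` the shrunken discs with different labels are strictly disjoint, since the centres
  -- are distinct; so an eigenvalue determines its label.
  have hdisj : ∀ t ∈ Set.Ico (0 : ℝ) 1, t ∈ A → t ∉ B := by
    rintro t ht ⟨-, r, hr, hd⟩ hB'
    simp only [hB, Set.mem_iUnion] at hB'
    obtain ⟨f, hf, -, r', hr', hd'⟩ := hB'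
    have := congrArg roots (hr'.symm.trans hr)
    rw [roots_prod_X_sub_C_univ, roots_prod_X_sub_C_univ] at this
    obtain ⟨σ, hσ⟩ := exists_perm_of_map_univ_eq this
    refine hf ⟨σ.symm, fun i => ?_⟩
    obtain ⟨j, hj, hj'⟩ := hd i
    obtain ⟨k, hk, hk'⟩ := hd' (σ.symm i)
    rw [← hσ, Equiv.apply_symm_apply] at hk'
    rw [mem_closedBall_iff_norm] at hj' hk'
    rw [← hk, ← show g j = g i from hj]
    by_contra hne
    obtain ⟨h1, h2⟩ := hsep k j hne
    have h3 : ‖M k k - M j j‖ ≤ t * (R k + R j) := by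
      have := norm_sub_le (r i - M j j) (r i - M k k)
      rw [sub_sub_sub_cancel_left] at this
      linarith
    have h4 : 0 < ‖M k k - M j j‖ := norm_pos_iff.mpr (sub_ne_zero.mpr h1)
    have h5 : t * (R k + R j) ≤ t * ‖M k k - M j j‖ := mul_le_mul_of_nonneg_left h2 ht.1
    nlinarith [ht.2]
  have h0 : (0 : ℝ) ∈ A := by
    refine ⟨⟨le_rfl, zero_le_one⟩, fun i => M i i, ?_, fun i => ⟨i, rfl, by simp⟩⟩
    have : scaleOffDiag M 0 = Matrix.diagonal fun i => M i i := by
      ext i j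
      by_cases h : i = j
      · subst h; simp [scaleOffDiag]
      · simp [scaleOffDiag, h]
    rw [this, Matrix.charpoly_diagonal]
  -- Connectedness is applied on `[0, 1)` only, because discs may touch at `t = 1`; that endpoint is
  -- reached by closedness of `A`.
  have hsub : Set.Ico (0 : ℝ) 1 ⊆ A := by
    intro t ht
    by_contra htA
    have htB : t ∈ B := (hcover ⟨ht.1, ht.2.le⟩).resolve_left htA
    obtain ⟨s, hs, hsA, hsB⟩ := isPreconnected_closed_iff.mp isPreconnected_Ico A B hAc hBc
      (Set.Ico_subset_Icc_self.trans hcover) ⟨0, ⟨le_rfl, zero_lt_one⟩, h0⟩ ⟨t, ht, htB⟩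
    exact hdisj s hs hsA hsB
  have h1 : (1 : ℝ) ∈ A := by
    have := closure_minimal hsub hAc
    rw [closure_Ico zero_ne_one] at this
    exact this ⟨zero_le_one, le_rfl⟩
  obtain ⟨-, r, hr, hd⟩ := h1
  have hM : scaleOffDiag M 1 = M := by ext i j; simp [scaleOffDiag]
  rw [hM] at hr
  exact ⟨r, hr, by simpa using hd⟩

/-- `exists_charpoly_eq_prod_of_separated` after conjugation with a positive diagonal matrix. -/
theorem exists_charpoly_eq_prod_of_separated_weighted {κ : Type*} (M : Matrix ι ι ℂ) (R : ι → ℝ)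
    (d : ι → ℝ) (hd : ∀ i, 0 < d i)
    (hR : ∀ j, ∑ i ∈ Finset.univ.erase j, ‖M i j‖ * (d i / d j) ≤ R j) (g : ι → κ)
    (hsep : ∀ i j, g i ≠ g j → M i i ≠ M j j ∧ R i + R j ≤ ‖M i i - M j j‖) :
    ∃ r : ι → ℂ, M.charpoly = ∏ i, (X - C (r i)) ∧
      ∀ i, ∃ j, g j = g i ∧ r i ∈ Metric.closedBall (M j j) (R j) := by
  have hd' : ∀ i, (d i : ℂ) ≠ 0 := fun i => by exact_mod_cast (hd i).ne'
  -- The conjugate has entries `M i j * d i / d j`: same diagonal, same characteristic polynomial.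
  let N : Matrix ι ι ℂ := Matrix.diagonal (fun i => (d i : ℂ)) * M *
    Matrix.diagonal (fun i => (d i : ℂ)⁻¹)
  have hN : ∀ i j, N i j = d i * M i j * (d j : ℂ)⁻¹ := fun i j => by
    simp [N, Matrix.mul_diagonal, Matrix.diagonal_mul]
  have hNd : ∀ j, N j j = M j j := fun j => by
    rw [hN, mul_comm, ← mul_assoc, inv_mul_cancel₀ (hd' j), one_mul]
  have hc : N.charpoly = M.charpoly := by
    rw [Matrix.charpoly_mul_comm, ← Matrix.mul_assoc, Matrix.diagonal_mul_diagonal]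
    have : (fun i => (d i : ℂ)⁻¹ * d i) = fun _ => 1 := by
      ext i; exact inv_mul_cancel₀ (hd' i)
    rw [this, Matrix.diagonal_one, Matrix.one_mul]
  have := exists_charpoly_eq_prod_of_separated N R (fun j => ?_) g
    (by simpa only [hNd] using hsep)
  · simpa only [hc, hNd] using this
  · refine le_trans (le_of_eq (Finset.sum_congr rfl fun i _ => ?_)) (hR j)
    rw [hN, norm_mul, norm_mul, norm_inv, Complex.norm_real, Complex.norm_real,
      Real.norm_of_nonneg (hd i).le, Real.norm_of_nonneg (hd j).le]
    ring

end Gershgorin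

/-! ### The squared companion matrix -/

/-- The companion matrix of the monic polynomial of degree `n` with lower coefficients `a`. -/
def companionMatrix (n : ℕ) (a : ℕ → ℂ) : Matrix (Fin n) (Fin n) ℂ :=
  Matrix.of fun i j => if (j : ℕ) + 1 = n then -a i else if (i : ℕ) = j + 1 then 1 else 0

/-- This is the matrix of multiplication by the root in the power basis of `AdjoinRoot q`; its
characteristic polynomial is the minimal polynomial of the root, which is `q`. -/
theorem charpoly_companionMatrix {n : ℕ} {q : ℂ[X]} (hq : q.Monic) (hd : q.natDegree = n) :
    (companionMatrix n q.coeff).charpoly = q := by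
  have hn : n = (AdjoinRoot.powerBasis hq.ne_zero).dim := by
    rw [AdjoinRoot.powerBasis_dim, hd]
  have h := charpoly_leftMulMatrix (AdjoinRoot.powerBasis hq.ne_zero)
  rw [PowerBasis.leftMulMatrix, PowerBasis.minpolyGen_eq,
    AdjoinRoot.minpoly_powerBasis_gen_of_monic hq] at h
  clear hd
  subst hn
  exact h

/-- Every complex number is a square `z ^ 2`, and `z ^ 2 - M ^ 2 = (z - M) * (z + M)`, whose
determinant is the product of the `(z - s i) * (z + s i)`. -/
theorem charpoly_mul_self {ι : Type*} [Fintype ι] [DecidableEq ι] {M : Matrix ι ι ℂ} {s : ι → ℂ}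
    (h : M.charpoly = ∏ i, (X - C (s i))) : (M * M).charpoly = ∏ i, (X - C (s i ^ 2)) := by
  have hev : ∀ z, (Matrix.scalar ι z - M).det = ∏ i, (z - s i) := fun z => by
    rw [← Matrix.eval_charpoly, h, eval_prod]; simp
  refine Polynomial.funext fun w => ?_
  obtain ⟨z, rfl⟩ := IsAlgClosed.exists_pow_nat_eq w (n := 2) (by norm_num)
  have hfac : Matrix.scalar ι (z ^ 2) - M * M
      = (Matrix.scalar ι z - M) * -(Matrix.scalar ι (-z) - M) := by
    have hcomm : Matrix.scalar ι z * M = M * Matrix.scalar ι z :=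
      Matrix.scalar_commute z (fun _ => mul_comm _ _) M
    rw [map_neg, pow_two, map_mul]
    simp only [neg_sub, sub_neg_eq_add, sub_mul, mul_add, hcomm]
    abel
  rw [Matrix.eval_charpoly, hfac, Matrix.det_mul, Matrix.det_neg, hev, hev, eval_prod,
    ← Finset.card_univ, ← Finset.prod_const, ← Finset.prod_mul_distrib, ← Finset.prod_mul_distrib]
  refine Finset.prod_congr rfl fun i _ => ?_
  simp only [eval_sub, eval_X, eval_C]
  ring

/-- The companion matrix sends `e_j` to `e_{j+1}` for `j + 1 < n` and `e_{n-1}` to `-a`. Applying it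
twice gives `e_{j+2}`, then `-a`, and for the last column the image of `-a`. -/
theorem companionMatrix_mul_self_apply {n : ℕ} (hn : 2 ≤ n) (a : ℕ → ℂ) (i j : Fin n) :
    (companionMatrix n a * companionMatrix n a) i j =
      if (j : ℕ) + 1 = n then a (n - 1) * a i - (if (i : ℕ) = 0 then 0 else a (i - 1))
      else if (j : ℕ) + 2 = n then -a i else if (i : ℕ) = j + 2 then 1 else 0 := by
  rw [Matrix.mul_apply]
  by_cases hj : (j : ℕ) + 1 = n
  · obtain ⟨k, rfl⟩ : ∃ k, n = k + 1 := ⟨j, hj.symm⟩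
    simp only [companionMatrix, Matrix.of_apply, if_pos hj]
    rw [Fin.sum_univ_castSucc]
    simp only [Fin.val_castSucc, Fin.val_last, if_true]
    have hne : ∀ x : Fin k, ¬ ((x : ℕ) + 1 = k + 1) := fun x => by omega
    simp only [hne, if_false, ite_mul, one_mul, zero_mul]
    by_cases hi : (i : ℕ) = 0
    · simp [hi]; ring
    · obtain ⟨i', hi'⟩ : ∃ i', (i : ℕ) = i' + 1 := ⟨i - 1, by omega⟩
      have hk : i' < k := by omega
      rw [Finset.sum_eq_single (⟨i', hk⟩ : Fin k)]
      · simp [hi']; ring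
      · intro b _ hb
        rw [if_neg]
        intro h
        exact hb (Fin.ext (by simp; omega))
      · simp
  · have hjn : (j : ℕ) + 1 < n := by omega
    rw [Finset.sum_eq_single (⟨j + 1, hjn⟩ : Fin n)]
    · simp [companionMatrix, hj, add_assoc]
    · intro b _ hb
      have : ¬ ((b : ℕ) = j + 1) := fun h => hb (Fin.ext h)
      simp [companionMatrix, hj, this]
    · simp

/-! ### Block form -/

/-- The `(i, j)` block of the block companion matrix with last block column `B`. -/
def companionBlock (m : ℕ) (B : ℕ → Matrix (Fin 2) (Fin 2) ℂ) (i j : Fin m) :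
    Matrix (Fin 2) (Fin 2) ℂ :=
  if (j : ℕ) + 1 = m then B i else if (i : ℕ) = j + 1 then 1 else 0

/-- The block companion matrix with last block column `B`. -/
def blockCompanion (m : ℕ) (B : ℕ → Matrix (Fin 2) (Fin 2) ℂ) :
    Matrix (Fin m × Fin 2) (Fin m × Fin 2) ℂ :=
  Matrix.of fun i j => companionBlock m B i.1 j.1 i.2 j.2

/-- The bijection `(j, d) ↦ 2 j + d`. -/
def pairEquiv (m : ℕ) : Fin m × Fin 2 ≃ Fin (2 * m) :=
  finProdFinEquiv.trans (finCongr (mul_comm m 2))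

theorem pairEquiv_val {m : ℕ} (i : Fin m × Fin 2) :
    (pairEquiv m i : ℕ) = 2 * i.1 + i.2 := by
  simp [pairEquiv, add_comm]

/-- With indices grouped in pairs, the shift by two becomes a shift by one block, and the two
exceptional columns form the last block column. -/
theorem blockCompanion_blockA {m : ℕ} (hm : 1 ≤ m) (a : ℕ → ℂ) :
    blockCompanion m (blockA (2 * m) a) =
      (companionMatrix (2 * m) a * companionMatrix (2 * m) a).submatrix
        (pairEquiv m) (pairEquiv m) := by
  ext ⟨i, c⟩ ⟨j, d⟩
  rw [Matrix.submatrix_apply, companionMatrix_mul_self_apply (by omega)]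
  simp only [pairEquiv_val, blockCompanion, companionBlock, Matrix.of_apply]
  by_cases hj : (j : ℕ) + 1 = m
  · rw [if_pos hj]
    fin_cases c <;> fin_cases d
    · have h1 : ¬ (2 * (j : ℕ) + 1 = 2 * m) := by omega
      have h2 : 2 * (j : ℕ) + 2 = 2 * m := by omega
      simp [blockA, h1, h2]
    · have h1 : 2 * (j : ℕ) + 1 + 1 = 2 * m := by omega
      simp [blockA, h1]
    · have h1 : ¬ (2 * (j : ℕ) + 1 = 2 * m) := by omega
      have h2 : 2 * (j : ℕ) + 2 = 2 * m := by omega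
      simp [blockA, h1, h2]
    · have h1 : 2 * (j : ℕ) + 1 + 1 = 2 * m := by omega
      simp [blockA, h1]
  · have h1 : ¬ (2 * (j : ℕ) + d + 1 = 2 * m) := by omega
    have h2 : ¬ (2 * (j : ℕ) + d + 2 = 2 * m) := by omega
    rw [if_neg hj, if_neg h1, if_neg h2]
    by_cases hi : (i : ℕ) = j + 1
    · rw [if_pos hi, hi, Matrix.one_apply]
      have : c = d ↔ (2 * ((j : ℕ) + 1) + c = 2 * j + d + 2) := by
        rw [Fin.ext_iff]; omega
      simp only [this]
    · have : ¬ (2 * (i : ℕ) + c = 2 * j + d + 2) := by omega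
      rw [if_neg hi, if_neg this]
      rfl

open Kronecker in
-- Conjugation by `1 ⊗ S` acts blockwise and fixes the identity and zero blocks, so only the last
-- block column changes.
theorem charpoly_blockCompanion_conj {m : ℕ} (B : ℕ → Matrix (Fin 2) (Fin 2) ℂ)
    {S : Matrix (Fin 2) (Fin 2) ℂ} (hS : IsUnit S.det) :
    (blockCompanion m fun j => S⁻¹ * B j * S).charpoly = (blockCompanion m B).charpoly := by
  have hB : ∀ i j : Fin m, companionBlock m (fun j => S⁻¹ * B j * S) i j
      = S⁻¹ * companionBlock m B i j * S := by
    intro i j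
    unfold companionBlock
    split_ifs
    · rfl
    · rw [Matrix.mul_one, Matrix.nonsing_inv_mul _ hS]
    · simp
  have key : blockCompanion m (fun j => S⁻¹ * B j * S)
      = ((1 : Matrix (Fin m) (Fin m) ℂ) ⊗ₖ S⁻¹) * blockCompanion m B *
        ((1 : Matrix (Fin m) (Fin m) ℂ) ⊗ₖ S) := by
    ext ⟨i, c⟩ ⟨j, d⟩
    simp only [blockCompanion, Matrix.of_apply, hB]
    simp only [Matrix.mul_apply, Fintype.sum_prod_type, Matrix.kroneckerMap_apply, Matrix.of_apply,
      Matrix.one_apply, ite_mul, mul_ite, one_mul, zero_mul, mul_zero]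
    simp
  rw [key, Matrix.charpoly_mul_comm, ← Matrix.mul_assoc, ← Matrix.mul_kronecker_mul,
    Matrix.mul_nonsing_inv _ hS, Matrix.mul_one, Matrix.one_kronecker_one, Matrix.one_mul]

/-- Enumeration of the roots of `q` by eigenvalue enumerations of the similar block companion
matrix. -/
theorem exists_roots_enumeration {m : ℕ} (hm : 1 ≤ m) {q : ℂ[X]} (hq : q.Monic)
    (hd : q.natDegree = 2 * m) {S : Matrix (Fin 2) (Fin 2) ℂ} (hS : IsUnit S.det)
    {r : Fin m × Fin 2 → ℂ}
    (hr : (blockCompanion m fun j => S⁻¹ * blockA (2 * m) q.coeff j * S).charpoly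
      = ∏ i, (X - C (r i))) :
    ∃ s : Fin m × Fin 2 → ℂ, q.roots = Finset.univ.val.map s ∧ ∀ i, s i ^ 2 = r i := by
  obtain ⟨s, hs⟩ := exists_eq_prod_X_sub_C (ι := Fin m × Fin 2) hq (by simp [hd, mul_comm])
  have hc : ((companionMatrix (2 * m) q.coeff).submatrix (pairEquiv m) (pairEquiv m)).charpoly
      = ∏ i, (X - C (s i)) := by
    rw [← hs]
    conv_rhs => rw [← charpoly_companionMatrix hq hd]
    have h := Matrix.charpoly_reindex (pairEquiv m).symm (companionMatrix (2 * m) q.coeff)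
    rwa [Matrix.reindex_apply, Equiv.symm_symm] at h
  have hc2 := charpoly_mul_self hc
  rw [Matrix.submatrix_mul_equiv, ← blockCompanion_blockA hm, ← charpoly_blockCompanion_conj _ hS,
    hr] at hc2
  have h := congrArg roots hc2
  rw [roots_prod_X_sub_C_univ, roots_prod_X_sub_C_univ] at h
  obtain ⟨σ, hσ⟩ := exists_perm_of_map_univ_eq h
  refine ⟨fun i => s (σ i), ?_, hσ⟩
  rw [hs, ← Equiv.prod_comp σ fun i => X - C (s i), roots_prod_X_sub_C_univ]

/-! ### Splitting the roots according to three discs -/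

/-- The members of `L` split into a multiset `Z` and two numbers `y`, `z` according to the discs of
centres `0`, `α`, `β` and radii `r 0`, `r 1`, `r 2` containing their squares, where discs with the
same label are merged, whenever discs with different labels are separated. -/
def DiscSplit (L : Multiset ℂ) (α β : ℂ) (r : Fin 3 → ℝ) : Prop :=
  ∀ g : Fin 3 → Fin 3,
    (∀ a b, g a ≠ g b → ![0, α, β] a ≠ ![0, α, β] b ∧
      r a + r b ≤ ‖![0, α, β] a - ![0, α, β] b‖) →
    ∃ (Z : Multiset ℂ) (y z : ℂ), L = Z + {y, z} ∧
      (∀ ζ ∈ Z, ∃ a, g a = g 0 ∧ ζ ^ 2 ∈ Metric.closedBall (![0, α, β] a) (r a)) ∧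
      (∃ a, g a = g 1 ∧ y ^ 2 ∈ Metric.closedBall (![0, α, β] a) (r a)) ∧
      (∃ a, g a = g 2 ∧ z ^ 2 ∈ Metric.closedBall (![0, α, β] a) (r a))

/-- The centre attached to an index: `0` for all but the last two, `1` and `2` for these. -/
def discKind (m : ℕ) (i : Fin m × Fin 2) : Fin 3 :=
  if (i.1 : ℕ) + 1 = m then i.2.succ else 0

/-- The weights `d` are left free to serve both scalings. A column outside the last block has a
single nonzero entry, the `1` one block below the diagonal, whence the radius `d (j + 1) c / d j c`
about `0`. The last diagonal block is triangular, so `γ` enters only the disc about `β`. -/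
theorem discSplit_roots {m : ℕ} (hm : 2 ≤ m) {q : ℂ[X]} (hq : q.Monic)
    (hd : q.natDegree = 2 * m) {S : Matrix (Fin 2) (Fin 2) ℂ} (hS : IsUnit S.det) {α β γ : ℂ}
    (hlast : S⁻¹ * blockA (2 * m) q.coeff (m - 1) * S = !![α, γ; 0, β]) {v w : ℕ → ℂ}
    (hvw : ∀ j < m - 1, !![v (2 * j), w (2 * j); v (2 * j + 1), w (2 * j + 1)]
      = S⁻¹ * blockA (2 * m) q.coeff j * S)
    (d : ℕ → Fin 2 → ℝ) (hdpos : ∀ j c, 0 < d j c) (r : Fin 3 → ℝ)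
    (hr0 : ∀ j c, d (j + 1) c / d j c ≤ r 0)
    (hr1 : ∑ j ∈ Finset.range (m - 1), (‖v (2 * j)‖ * (d j 0 / d (m - 1) 0)
      + ‖v (2 * j + 1)‖ * (d j 1 / d (m - 1) 0)) ≤ r 1)
    (hr2 : ‖γ‖ * (d (m - 1) 0 / d (m - 1) 1)
      + ∑ j ∈ Finset.range (m - 1), (‖w (2 * j)‖ * (d j 0 / d (m - 1) 1)
      + ‖w (2 * j + 1)‖ * (d j 1 / d (m - 1) 1)) ≤ r 2) :
    DiscSplit q.roots α β r := by
  intro g hsep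
  obtain ⟨k, rfl⟩ : ∃ k, m = k + 1 := ⟨m - 1, by omega⟩
  simp only [Nat.add_sub_cancel] at *
  set M := blockCompanion (k + 1) fun j => S⁻¹ * blockA (2 * (k + 1)) q.coeff j * S with hM
  have hMlast : ∀ (i : Fin (k + 1)) (c e : Fin 2), M (i, c) (Fin.last k, e)
      = (S⁻¹ * blockA (2 * (k + 1)) q.coeff i * S) c e := by
    intro i c e; simp [hM, blockCompanion, companionBlock]
  have hMcast : ∀ (i : Fin (k + 1)) (j : Fin k) (c e : Fin 2), M (i, c) (j.castSucc, e)
      = if i = j.succ ∧ c = e then 1 else 0 := by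
    intro i j c e
    have h1 : ¬ ((j : ℕ) = k) := by omega
    simp only [hM, blockCompanion, companionBlock, Matrix.of_apply, Fin.val_castSucc,
      Nat.add_right_cancel_iff, h1, if_false]
    by_cases hi : (i : ℕ) = j + 1
    · have : i = j.succ := Fin.ext (by simpa using hi)
      simp [this, Matrix.one_apply]
    · have : ¬ i = j.succ := fun h => hi (by rw [h]; simp)
      simp [hi, this]
  have hkind0 : ∀ (j : Fin k) (e : Fin 2), discKind (k + 1) (j.castSucc, e) = 0 := by
    intro j e
    have h1 : ¬ ((j : ℕ) = k) := by omega
    simp [discKind, h1]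
  have hkind1 : ∀ e : Fin 2, discKind (k + 1) (Fin.last k, e) = e.succ := by
    intro e; simp [discKind]
  have hcentre : ∀ i, M i i = ![0, α, β] (discKind (k + 1) i) := by
    rintro ⟨i, c⟩
    induction i using Fin.lastCases with
    | last =>
      rw [hMlast, hkind1, Fin.val_last, hlast]
      fin_cases c <;> rfl
    | cast i =>
      rw [hMcast, hkind0, if_neg]
      · rfl
      · rintro ⟨h, -⟩
        have := congrArg Fin.val h
        simp at this
  have hcol : ∀ j, ∑ i ∈ Finset.univ.erase j, ‖M i j‖ * (d i.1 i.2 / d j.1 j.2)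
      ≤ r (discKind (k + 1) j) := by
    rintro ⟨j, e⟩
    simp only
    induction j using Fin.lastCases with
    | last =>
      have hvw' : ∀ i : Fin k, S⁻¹ * blockA (2 * (k + 1)) q.coeff (i : ℕ) * S
          = !![v (2 * i), w (2 * i); v (2 * i + 1), w (2 * i + 1)] :=
        fun i => (hvw i i.2).symm
      rw [hkind1, Finset.sum_erase_eq_sub (Finset.mem_univ _), Fintype.sum_prod_type,
        Fin.sum_univ_castSucc]
      rw [← Fin.sum_univ_eq_sum_range (fun j => ‖v (2 * j)‖ * (d j 0 / d k 0)
        + ‖v (2 * j + 1)‖ * (d j 1 / d k 0))] at hr1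
      rw [← Fin.sum_univ_eq_sum_range (fun j => ‖w (2 * j)‖ * (d j 0 / d k 1)
        + ‖w (2 * j + 1)‖ * (d j 1 / d k 1))] at hr2
      simp only [Fin.sum_univ_two, hMlast, Fin.val_castSucc, Fin.val_last, hvw', hlast]
      fin_cases e
      · refine le_trans (le_of_eq ?_) hr1
        simp
      · refine le_trans (le_of_eq ?_) hr2
        simp
        ring
    | cast j =>
      rw [hkind0]
      refine le_trans ?_ (hr0 j e)
      rw [Finset.sum_eq_single_of_mem (j.succ, e)]
      · simp [hMcast]
      · rw [Finset.mem_erase]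
        refine ⟨fun h => ?_, Finset.mem_univ _⟩
        have := congrArg (fun x => (x.1 : ℕ)) h
        simp at this
      · rintro ⟨i, c⟩ - hi
        rw [hMcast, if_neg]
        · simp
        · rintro ⟨rfl, rfl⟩; exact hi rfl
  obtain ⟨s, hs, hs'⟩ := exists_charpoly_eq_prod_of_separated_weighted M
    (fun i => r (discKind (k + 1) i)) (fun i => d i.1 i.2) (fun i => hdpos _ _) hcol
    (fun i => g (discKind (k + 1) i)) (fun i j hij => by
      simpa only [hcentre] using hsep _ _ hij)
  · obtain ⟨t, ht, ht'⟩ := exists_roots_enumeration (by omega) hq hd hS hs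
    have hy : ((Fin.last k, 0) : Fin (k + 1) × Fin 2) ∈ (Finset.univ : Finset _).val :=
      Finset.mem_univ _
    have hz : ((Fin.last k, 1) : Fin (k + 1) × Fin 2) ∈
        ((Finset.univ : Finset (Fin (k + 1) × Fin 2)).erase (Fin.last k, 0)).val := by
      rw [Finset.mem_val, Finset.mem_erase]; simp
    refine ⟨(((Finset.univ : Finset (Fin (k + 1) × Fin 2)).erase (Fin.last k, 0)).erase
      (Fin.last k, 1)).val.map t, t (Fin.last k, 0), t (Fin.last k, 1), ?_, ?_, ?_, ?_⟩
    · rw [ht, ← Multiset.cons_erase hy, ← Finset.erase_val, ← Multiset.cons_erase hz,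
        ← Finset.erase_val, Multiset.map_cons, Multiset.map_cons,
        Multiset.insert_eq_cons, add_comm (Multiset.map t _), Multiset.cons_add, Multiset.singleton_add]
    · intro ζ hζ
      obtain ⟨⟨i, c⟩, hi, rfl⟩ := Multiset.mem_map.mp hζ
      rw [Finset.mem_val, Finset.mem_erase, Finset.mem_erase] at hi
      obtain ⟨j, hj, hj'⟩ := hs' (i, c)
      rw [hcentre] at hj'
      refine ⟨_, ?_, by rw [ht']; exact hj'⟩
      rw [hj]
      induction i using Fin.lastCases with
      | last =>
        fin_cases c
        · exact absurd rfl hi.2.1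
        · exact absurd rfl hi.1
      | cast i => rw [hkind0]
    · obtain ⟨j, hj, hj'⟩ := hs' (Fin.last k, 0)
      rw [hcentre] at hj'
      exact ⟨_, by rw [hj, hkind1]; rfl, by rw [ht']; exact hj'⟩
    · obtain ⟨j, hj, hj'⟩ := hs' (Fin.last k, 1)
      rw [hcentre] at hj'
      exact ⟨_, by rw [hj, hkind1]; rfl, by rw [ht']; exact hj'⟩

theorem sum_range_two_mul (f : ℕ → ℝ) (N : ℕ) :
    ∑ k ∈ Finset.range (2 * N), f k = ∑ j ∈ Finset.range N, (f (2 * j) + f (2 * j + 1)) := by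
  induction N with
  | zero => simp
  | succ N ih =>
    rw [Nat.mul_succ, Finset.sum_range_succ, Finset.sum_range_succ, ih, Finset.sum_range_succ]
    ring

/-! ### The diagonal and the block-diagonal scaling -/

section Scaling

variable {m : ℕ} (hm : 2 ≤ m) {q : ℂ[X]} (hq : q.Monic)
    (hd : q.natDegree = 2 * m) {S : Matrix (Fin 2) (Fin 2) ℂ} (hS : IsUnit S.det) {α β γ : ℂ}
    (hlast : S⁻¹ * blockA (2 * m) q.coeff (m - 1) * S = !![α, γ; 0, β]) {v w : ℕ → ℂ}
    (hvw : ∀ j < m - 1, !![v (2 * j), w (2 * j); v (2 * j + 1), w (2 * j + 1)]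
      = S⁻¹ * blockA (2 * m) q.coeff j * S) {x : ℝ} (hx : 0 < x)

include hm hq hd hS hlast hvw hx

theorem discSplit_rho : DiscSplit q.roots α β ![x ^ 2, rho1 (2 * m) v x, rho2 (2 * m) γ w x] := by
  -- The scalar index `k = 2 * j + c` has weight `x ^ k`.
  refine discSplit_roots hm hq hd hS hlast hvw (fun j c => x ^ (2 * j + (c : ℕ)))
    (fun j c => by positivity) _ (fun j c => le_of_eq ?_) (le_of_eq ?_) (le_of_eq ?_)
  · show _ = x ^ 2
    field_simp
    ring
  · show _ = rho1 (2 * m) v x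
    rw [rho1, show 2 * m - 2 = 2 * (m - 1) by omega, sum_range_two_mul]
    refine Finset.sum_congr rfl fun j hj => ?_
    have hj := Finset.mem_range.mp hj
    obtain ⟨e, he⟩ : ∃ e, m - 1 = j + e + 1 := ⟨m - 1 - j - 1, by omega⟩
    rw [he, show 2 * (j + e + 1) - 2 * j = 2 * e + 2 by omega,
      show 2 * (j + e + 1) - (2 * j + 1) = 2 * e + 1 by omega]
    simp only [Fin.val_zero, Fin.val_one]
    field_simp
    ring
  · show _ = rho2 (2 * m) γ w x
    rw [rho2, show 2 * m - 2 = 2 * (m - 1) by omega, sum_range_two_mul]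
    congr 1
    · simp only [Fin.val_zero, Fin.val_one]
      field_simp
      ring
    refine Finset.sum_congr rfl fun j hj => ?_
    have hj := Finset.mem_range.mp hj
    obtain ⟨e, he⟩ : ∃ e, m - 1 = j + e + 1 := ⟨m - 1 - j - 1, by omega⟩
    rw [he, show 2 * m - 1 - 2 * j = 2 * e + 3 by omega,
      show 2 * m - 1 - (2 * j + 1) = 2 * e + 2 by omega]
    simp only [Fin.val_zero, Fin.val_one]
    field_simp
    ring

theorem discSplit_sigma : DiscSplit q.roots α β ![x, sigma1 m v x, sigma2 m γ w x] := by
  -- The weight is constant on each block, so `γ` is not divided by `x` and the disc about `0` has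
  -- radius `x`.
  refine discSplit_roots hm hq hd hS hlast hvw (fun j _ => x ^ j)
    (fun j c => by positivity) _ (fun j c => le_of_eq ?_) (le_of_eq ?_) (le_of_eq ?_)
  · show _ = x
    field_simp
    ring
  · show _ = sigma1 m v x
    rw [sigma1]
    refine Finset.sum_congr rfl fun j hj => ?_
    have hj := Finset.mem_range.mp hj
    obtain ⟨e, he⟩ : ∃ e, m - 1 = j + e + 1 := ⟨m - 1 - j - 1, by omega⟩
    rw [he, show j + e + 1 - j = e + 1 by omega]
    field_simp
    ring
  · show _ = sigma2 m γ w x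
    rw [sigma2]
    congr 1
    · field_simp
    refine Finset.sum_congr rfl fun j hj => ?_
    have hj := Finset.mem_range.mp hj
    obtain ⟨e, he⟩ : ∃ e, m - 1 = j + e + 1 := ⟨m - 1 - j - 1, by omega⟩
    rw [he, show j + e + 1 - j = e + 1 by omega]
    field_simp
    ring

end Scaling

/-! ### Separated discs -/

/-- For odd `ℓ` the factor `X` adds a zero at the origin. The distinguished zeros in `W` are
nonzero, so it can be discarded from `Z`. -/
theorem exists_add_of_cons_zero {L L' Z W : Multiset ℂ} (hL : L = L' ∨ L = 0 ::ₘ L')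
    (h : L = Z + W) (hW : ∀ ζ ∈ W, ζ ≠ 0) : ∃ Z', L' = Z' + W ∧ ∀ ζ ∈ Z', ζ ∈ Z := by
  rcases hL with rfl | rfl
  · exact ⟨Z, h, fun _ => id⟩
  · have h0 : (0 : ℂ) ∈ Z + W := h ▸ Multiset.mem_cons_self 0 L'
    have h0Z : (0 : ℂ) ∈ Z :=
      (Multiset.mem_add.mp h0).resolve_right fun h0W => hW 0 h0W rfl
    obtain ⟨Z', rfl⟩ := Multiset.exists_cons_of_mem h0Z
    rw [Multiset.cons_add] at h
    exact ⟨Z', (Multiset.cons_inj_right 0).mp h, fun ζ hζ => Multiset.mem_cons_of_mem hζ⟩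

theorem sub_le_norm_of_mem_closedBall {c z : ℂ} {r : ℝ} (h : z ∈ Metric.closedBall c r) :
    ‖c‖ - r ≤ ‖z‖ := by
  rw [mem_closedBall_iff_norm'] at h
  have := norm_sub_norm_le c z
  linarith

theorem ne_zero_of_sq_mem_closedBall {c z : ℂ} {r₀ r : ℝ} (h0 : 0 < r₀) (hc : r₀ + r ≤ ‖c‖)
    (h : z ^ 2 ∈ Metric.closedBall c r) : z ≠ 0 := by
  rintro rfl
  have := sub_le_norm_of_mem_closedBall h
  simp at this
  linarith

section Separation

variable {L L' : Multiset ℂ} {α β : ℂ} {r₀ r₁ r₂ : ℝ}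

theorem DiscSplit.exists_pair (h : DiscSplit L α β ![r₀, r₁, r₂]) (hL : L = L' ∨ L = 0 ::ₘ L')
    (h0 : 0 < r₀) (h1 : 0 ≤ r₁) (h2 : 0 ≤ r₂) (hα : r₀ + r₁ ≤ ‖α‖) (hβ : r₀ + r₂ ≤ ‖β‖) :
    ∃ (Z : Multiset ℂ) (y z : ℂ), L' = Z + {y, z} ∧ (∀ ζ ∈ Z, ‖ζ‖ ^ 2 ≤ r₀) ∧
      y ^ 2 ∈ Metric.closedBall α r₁ ∪ Metric.closedBall β r₂ ∧
      z ^ 2 ∈ Metric.closedBall α r₁ ∪ Metric.closedBall β r₂ ∧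
      (r₁ + r₂ < ‖α - β‖ → y ^ 2 ∈ Metric.closedBall α r₁ ∧ z ^ 2 ∈ Metric.closedBall β r₂) := by
  have hα0 : α ≠ 0 := norm_pos_iff.mp (by linarith)
  have hβ0 : β ≠ 0 := norm_pos_iff.mp (by linarith)
  suffices hs : ∃ (Z : Multiset ℂ) (y z : ℂ), L = Z + {y, z} ∧
      (∀ ζ ∈ Z, ζ ^ 2 ∈ Metric.closedBall 0 r₀) ∧
      y ^ 2 ∈ Metric.closedBall α r₁ ∪ Metric.closedBall β r₂ ∧
      z ^ 2 ∈ Metric.closedBall α r₁ ∪ Metric.closedBall β r₂ ∧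
      (r₁ + r₂ < ‖α - β‖ → y ^ 2 ∈ Metric.closedBall α r₁ ∧ z ^ 2 ∈ Metric.closedBall β r₂) by
    obtain ⟨Z, y, z, hLe, hZ, hy, hz, hyz⟩ := hs
    have hne : ∀ x : ℂ, x ^ 2 ∈ Metric.closedBall α r₁ ∪ Metric.closedBall β r₂ → x ≠ 0 := by
      rintro x (hx | hx)
      · exact ne_zero_of_sq_mem_closedBall h0 hα hx
      · exact ne_zero_of_sq_mem_closedBall h0 hβ hx
    obtain ⟨Z', hL', hZ'⟩ := exists_add_of_cons_zero hL hLe (by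
      intro ζ hζ
      rw [Multiset.insert_eq_cons, Multiset.mem_cons, Multiset.mem_singleton] at hζ
      rcases hζ with rfl | rfl
      · exact hne _ hy
      · exact hne _ hz)
    refine ⟨Z', y, z, hL', fun ζ hζ => ?_, hy, hz, hyz⟩
    simpa using hZ ζ (hZ' ζ hζ)
  -- Three separate labels if the discs about `α` and `β` are disjoint; otherwise these two discs
  -- are merged.
  by_cases hs : r₁ + r₂ < ‖α - β‖
  · have hαβ : α ≠ β := by
      rintro rfl
      simp at hs
      linarith
    obtain ⟨Z, y, z, hLe, hZ, hy, hz⟩ := h id (by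
      intro a b hab
      fin_cases a <;> fin_cases b <;>
        simp_all [hα0.symm, hβ0.symm, hαβ.symm, add_comm r₁ r₀, add_comm r₂ r₀, norm_sub_rev β α,
          add_comm r₂ r₁, hs.le])
    simp only [id, exists_eq_left] at hZ hy hz
    exact ⟨Z, y, z, hLe, hZ, Or.inl hy, Or.inr hz, fun _ => ⟨hy, hz⟩⟩
  · obtain ⟨Z, y, z, hLe, hZ, hy, hz⟩ := h ![0, 1, 1] (by
      intro a b hab
      fin_cases a <;> fin_cases b <;>
        simp_all [hα0.symm, hβ0.symm, add_comm r₁ r₀, add_comm r₂ r₀])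
    refine ⟨Z, y, z, hLe, fun ζ hζ => ?_, ?_, ?_, fun h => absurd h hs⟩
    · simpa [Fin.exists_fin_succ] using hZ ζ hζ
    · simpa [Fin.exists_fin_succ] using hy
    · simpa [Fin.exists_fin_succ] using hz

theorem DiscSplit.exists_left (h : DiscSplit L α β ![r₀, r₁, r₂]) (hL : L = L' ∨ L = 0 ::ₘ L')
    (h0 : 0 < r₀) (h1 : 0 ≤ r₁) (h2 : 0 ≤ r₂) (hα : r₀ + r₁ ≤ ‖α‖) (hs : r₁ + r₂ < ‖α - β‖) :
    ∃ (Z : Multiset ℂ) (y : ℂ), L' = Z + {y} ∧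
      (∀ ζ ∈ Z, ζ ^ 2 ∈ Metric.closedBall 0 r₀ ∪ Metric.closedBall β r₂) ∧
      y ^ 2 ∈ Metric.closedBall α r₁ := by
  have hα0 : α ≠ 0 := norm_pos_iff.mp (by linarith)
  have hαβ : α ≠ β := by
    rintro rfl
    simp at hs
    linarith
  -- Nothing is known about the discs about `0` and `β` relative to each other, so they share a
  -- label and `z` joins `Z`.
  obtain ⟨Z, y, z, hLe, hZ, hy, hz⟩ := h ![0, 1, 0] (by
    intro a b hab
    fin_cases a <;> fin_cases b <;>
      simp_all [hα0.symm, hαβ.symm, add_comm r₁ r₀, norm_sub_rev β α, add_comm r₂ r₁, hs.le])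
  replace hy : y ^ 2 ∈ Metric.closedBall α r₁ := by simpa [Fin.exists_fin_succ] using hy
  obtain ⟨Z', hL', hZ'⟩ := exists_add_of_cons_zero (Z := Z + {z}) (W := {y}) hL (by
    rw [hLe, add_assoc, Multiset.singleton_add, Multiset.pair_comm]; rfl) (by
    intro ζ hζ
    rw [Multiset.mem_singleton.mp hζ]
    exact ne_zero_of_sq_mem_closedBall h0 hα hy)
  refine ⟨Z', y, hL', fun ζ hζ => ?_, hy⟩
  rcases Multiset.mem_add.mp (hZ' ζ hζ) with hζ | hζ
  · simpa [Fin.exists_fin_succ] using hZ ζ hζ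
  · rw [Multiset.mem_singleton.mp hζ]
    simpa [Fin.exists_fin_succ] using hz

theorem DiscSplit.exists_right (h : DiscSplit L α β ![r₀, r₁, r₂]) (hL : L = L' ∨ L = 0 ::ₘ L')
    (h0 : 0 < r₀) (h1 : 0 ≤ r₁) (h2 : 0 ≤ r₂) (hβ : r₀ + r₂ ≤ ‖β‖) (hs : r₁ + r₂ < ‖α - β‖) :
    ∃ (Z : Multiset ℂ) (y : ℂ), L' = Z + {y} ∧
      (∀ ζ ∈ Z, ζ ^ 2 ∈ Metric.closedBall 0 r₀ ∪ Metric.closedBall α r₁) ∧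
      y ^ 2 ∈ Metric.closedBall β r₂ := by
  have hβ0 : β ≠ 0 := norm_pos_iff.mp (by linarith)
  have hαβ : α ≠ β := by
    rintro rfl
    simp at hs
    linarith
  obtain ⟨Z, y, z, hLe, hZ, hy, hz⟩ := h ![0, 0, 1] (by
    intro a b hab
    fin_cases a <;> fin_cases b <;>
      simp_all [hβ0.symm, hαβ.symm, add_comm r₂ r₀, norm_sub_rev β α, add_comm r₂ r₁, hs.le])
  replace hz : z ^ 2 ∈ Metric.closedBall β r₂ := by simpa [Fin.exists_fin_succ] using hz
  obtain ⟨Z', hL', hZ'⟩ := exists_add_of_cons_zero (Z := Z + {y}) (W := {z}) hL (by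
    rw [hLe, add_assoc, Multiset.singleton_add]; rfl) (by
    intro ζ hζ
    rw [Multiset.mem_singleton.mp hζ]
    exact ne_zero_of_sq_mem_closedBall h0 hβ hz)
  refine ⟨Z', z, hL', fun ζ hζ => ?_, hz⟩
  rcases Multiset.mem_add.mp (hZ' ζ hζ) with hζ | hζ
  · simpa [Fin.exists_fin_succ] using hZ ζ hζ
  · rw [Multiset.mem_singleton.mp hζ]
    simpa [Fin.exists_fin_succ] using hy

end Separation

/-- Two splittings of `L` with different bounds on the small part, the larger of which is also a
lower bound for the pair in the second splitting, have the same small part. -/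
theorem norm_sq_le_of_splittings {L Z Z' : Multiset ℂ} {y z y' z' : ℂ} {r r' : ℝ} (hrr : r ≤ r')
    (hL : L = Z + {y, z}) (hZ : ∀ ζ ∈ Z, ‖ζ‖ ^ 2 ≤ r)
    (hL' : L = Z' + {y', z'}) (hZ' : ∀ ζ ∈ Z', ‖ζ‖ ^ 2 ≤ r')
    (hy' : r' ≤ ‖y'‖ ^ 2) (hz' : r' ≤ ‖z'‖ ^ 2) : ∀ ζ ∈ Z', ‖ζ‖ ^ 2 ≤ r := by
  rcases hrr.eq_or_lt with rfl | hlt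
  · exact hZ'
  classical
  have hF : ∀ W : Multiset ℂ, (∀ ζ ∈ W, r' ≤ ‖ζ‖ ^ 2) → W.filter (fun ζ => r' ≤ ‖ζ‖ ^ 2) = W :=
    fun W hW => Multiset.filter_eq_self.mpr hW
  have hZF : Z.filter (fun ζ => r' ≤ ‖ζ‖ ^ 2) = 0 :=
    Multiset.filter_eq_nil.mpr fun ζ hζ h => by linarith [hZ ζ hζ]
  have hyz' : ({y', z'} : Multiset ℂ).filter (fun ζ => r' ≤ ‖ζ‖ ^ 2) = {y', z'} := by
    refine hF _ fun ζ hζ => ?_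
    rw [Multiset.insert_eq_cons, Multiset.mem_cons, Multiset.mem_singleton] at hζ
    rcases hζ with rfl | rfl <;> assumption
  -- The filter keeps `y'` and `z'` but nothing of `Z`, since `r < r'`. Hence the two pairs
  -- coincide, and so do the remainders.
  have h1 := congrArg (Multiset.filter fun ζ => r' ≤ ‖ζ‖ ^ 2) (hL'.symm.trans hL)
  rw [Multiset.filter_add, Multiset.filter_add, hZF, hyz', zero_add] at h1
  have hle : ({y', z'} : Multiset ℂ) ≤ {y, z} :=
    (Multiset.le_add_left _ _).trans (h1.le.trans (Multiset.filter_le _ _))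
  have heq : ({y', z'} : Multiset ℂ) = {y, z} := Multiset.eq_of_le_of_card_le hle (by simp)
  have hZZ : Z' = Z := by
    have := hL'.symm.trans hL
    rw [heq] at this
    exact add_right_cancel this
  exact hZZ ▸ hZ

/-! ### Positive roots -/

theorem HasPosRoots.pos {q : ℝ[X]} {s t : ℝ} (h : HasPosRoots q s t) : 0 < s := by
  have hs : s ∈ q.roots.filter (fun x => 0 < x) := by rw [h.2]; simp
  exact (Multiset.mem_filter.mp hs).2

theorem HasPosRoots.unique {q : ℝ[X]} {s t s' t' : ℝ} (h : HasPosRoots q s t)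
    (h' : HasPosRoots q s' t') : s = s' ∧ t = t' := by
  have he : ({s, t} : Multiset ℝ) = {s', t'} := h.2.symm.trans h'.2
  have hsum := congrArg Multiset.sum he
  have hs : s ∈ ({s', t'} : Multiset ℝ) := by rw [← he]; simp
  simp at hsum hs
  have h1 := h.1
  have h2 := h'.1
  rcases hs with hs | hs <;> constructor <;> linarith

/-- A real polynomial with arbitrarily large positive values and exactly two positive roots is
nonpositive between them. -/
theorem HasPosRoots.eval_nonpos {q : ℝ[X]} {s t x : ℝ} (h : HasPosRoots q s t)
    (hq : ∀ N : ℝ, ∃ y > N, 0 < q.eval y) (hx : x ∈ Set.Icc s t) : q.eval x ≤ 0 := by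
  have hq0 : q ≠ 0 := by
    rintro rfl
    obtain ⟨y, -, hy⟩ := hq 0
    simp at hy
  have hle : ({s, t} : Multiset ℝ) ≤ q.roots := h.2 ▸ Multiset.filter_le _ _
  -- The cofactor `r` of `(X - s) * (X - t)` has no positive root and is positive far out, hence
  -- positive on the whole half-line; the sign of `q` is that of the quadratic factor.
  obtain ⟨r, hr⟩ := (Multiset.prod_X_sub_C_dvd_iff_le_roots hq0 _).mpr hle
  have hroots : q.roots = {s, t} + r.roots := by
    conv_lhs => rw [hr]
    rw [roots_mul (hr ▸ hq0), roots_multiset_prod_X_sub_C]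
  have hst : ({s, t} : Multiset ℝ).filter (fun x => 0 < x) = {s, t} := by
    refine Multiset.filter_eq_self.mpr fun a ha => ?_
    rw [← h.2] at ha
    exact (Multiset.mem_filter.mp ha).2
  have hrpos : r.roots.filter (fun x => 0 < x) = 0 := by
    have := h.2
    rw [hroots, Multiset.filter_add, hst] at this
    exact add_eq_left.mp this
  have hr0 : r ≠ 0 := by
    rintro rfl
    exact hq0 (by rw [hr, mul_zero])
  have hne : ∀ y, 0 < y → r.eval y ≠ 0 := by
    intro y hy h0
    have : y ∈ r.roots.filter (fun x => 0 < x) :=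
      Multiset.mem_filter.mpr ⟨(mem_roots hr0).mpr h0, hy⟩
    rw [hrpos] at this
    simp at this
  have hev : ∀ y, q.eval y = (y - s) * (y - t) * r.eval y := by
    intro y
    rw [hr]
    simp
  have hxpos : 0 < x := h.pos.trans_le hx.1
  have hrx : 0 < r.eval x := by
    by_contra hneg
    obtain ⟨y, hyt, hy⟩ := hq t
    rw [hev] at hy
    have hst' := h.1
    have hry : 0 < r.eval y := by
      refine pos_of_mul_pos_right hy (mul_nonneg ?_ ?_) <;> linarith
    have hxy : x ≤ y := hx.2.trans hyt.le
    obtain ⟨c, hc, hc0⟩ := intermediate_value_Icc hxy (f := fun u => r.eval u)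
      r.continuous.continuousOn ⟨not_lt.mp hneg, hry.le⟩
    exact hne c (hxpos.trans_le hc.1) hc0
  rw [hev]
  exact mul_nonpos_of_nonpos_of_nonneg
    (mul_nonpos_of_nonneg_of_nonpos (by linarith [hx.1]) (by linarith [hx.2])) hrx.le

/-- `HasPosRoots.eval_nonpos` for polynomials of the form `x ^ k (ψ(x) - A + ρ(x))`. -/
theorem HasPosRoots.add_le {q : ℝ[X]} {s t x A : ℝ} {k : ℕ} {ψ ρ : ℝ → ℝ} (h : HasPosRoots q s t)
    (hq : ∀ x, 0 < x → q.eval x = x ^ k * (ψ x - A + ρ x)) (hψ : ∀ x, 1 ≤ x → x ≤ ψ x)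
    (hρ : ∀ x, 0 < x → 0 ≤ ρ x) (hx : x ∈ Set.Icc s t) : ψ x + ρ x ≤ A := by
  have hx0 : 0 < x := h.pos.trans_le hx.1
  have := h.eval_nonpos (fun N => ?_) hx
  · rw [hq x hx0] at this
    have := nonpos_of_mul_nonpos_right this (pow_pos hx0 k)
    linarith
  · refine ⟨|N| + |A| + 1, by linarith [le_abs_self N, abs_nonneg A], ?_⟩
    have hy1 : 1 ≤ |N| + |A| + 1 := by linarith [abs_nonneg N, abs_nonneg A]
    have hy0 : 0 < |N| + |A| + 1 := by linarith
    rw [hq _ hy0]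
    have h1 := hψ _ hy1
    have h2 := hρ _ hy0
    refine mul_pos (pow_pos hy0 k) ?_
    linarith [le_abs_self A, abs_nonneg N]

theorem rho1_nonneg (n : ℕ) (v : ℕ → ℂ) (x : ℝ) (hx : 0 < x) : 0 ≤ rho1 n v x := by
  unfold rho1; positivity

theorem rho2_nonneg (n : ℕ) (γ : ℂ) (w : ℕ → ℂ) (x : ℝ) (hx : 0 < x) : 0 ≤ rho2 n γ w x := by
  unfold rho2; positivity

theorem sigma1_nonneg (m : ℕ) (v : ℕ → ℂ) (x : ℝ) (hx : 0 < x) : 0 ≤ sigma1 m v x := by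
  unfold sigma1; positivity

theorem sigma2_nonneg (m : ℕ) (γ : ℂ) (w : ℕ → ℂ) (x : ℝ) (hx : 0 < x) :
    0 ≤ sigma2 m γ w x := by
  unfold sigma2; positivity

/-- This turns the sign of the polynomial into the separation condition for the discs about `0` and
`α`; the next three lemmas do the same for the other polynomials. -/
theorem eval_chi1 {n : ℕ} (hn : 2 ≤ n) (α : ℂ) (v : ℕ → ℂ) (x : ℝ) (hx : 0 < x) :
    (chi1 n α v).eval x = x ^ (n - 2) * (x ^ 2 - ‖α‖ + rho1 n v x) := by
  have hs : x ^ (n - 2) * rho1 n v x = ∑ k ∈ Finset.range (n - 2), ‖v k‖ * x ^ k := by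
    rw [rho1, Finset.mul_sum]
    refine Finset.sum_congr rfl fun k hk => ?_
    have hk := Finset.mem_range.mp hk
    rw [show x ^ (n - 2) = x ^ k * x ^ (n - 2 - k) by rw [← pow_add]; congr 1; omega]
    field_simp
  rw [mul_add, hs, mul_sub, ← pow_add, Nat.sub_add_cancel hn]
  simp only [chi1, eval_finsetSum, eval_add, eval_sub, eval_mul, eval_pow, eval_X, eval_C]
  ring

theorem eval_chi2 {n : ℕ} (hn : 2 ≤ n) (β γ : ℂ) (w : ℕ → ℂ) (x : ℝ) (hx : 0 < x) :
    (chi2 n β γ w).eval x = x ^ (n - 1) * (x ^ 2 - ‖β‖ + rho2 n γ w x) := by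
  have hs : x ^ (n - 1) * rho2 n γ w x
      = ‖γ‖ * x ^ (n - 2) + ∑ k ∈ Finset.range (n - 2), ‖w k‖ * x ^ k := by
    rw [rho2, mul_add, Finset.mul_sum]
    congr 1
    · rw [show x ^ (n - 1) = x ^ (n - 2) * x by rw [← pow_succ]; congr 1; omega]
      field_simp
    refine Finset.sum_congr rfl fun k hk => ?_
    have hk := Finset.mem_range.mp hk
    rw [show x ^ (n - 1) = x ^ k * x ^ (n - 1 - k) by rw [← pow_add]; congr 1; omega]
    field_simp
  rw [mul_add, hs, mul_sub, ← pow_add, show n - 1 + 2 = n + 1 by omega]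
  simp only [chi2, eval_finsetSum, eval_add, eval_sub, eval_mul, eval_pow, eval_X, eval_C]
  ring

theorem eval_omega1 {m : ℕ} (hm : 1 ≤ m) (α : ℂ) (v : ℕ → ℂ) (x : ℝ) (hx : 0 < x) :
    (omega1 m α v).eval x = x ^ (m - 1) * (x - ‖α‖ + sigma1 m v x) := by
  have hs : x ^ (m - 1) * sigma1 m v x
      = ∑ j ∈ Finset.range (m - 1), (‖v (2 * j + 1)‖ + ‖v (2 * j)‖) * x ^ j := by
    rw [sigma1, Finset.mul_sum]
    refine Finset.sum_congr rfl fun k hk => ?_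
    have hk := Finset.mem_range.mp hk
    rw [show x ^ (m - 1) = x ^ k * x ^ (m - 1 - k) by rw [← pow_add]; congr 1; omega]
    field_simp
  rw [mul_add, hs, mul_sub, ← pow_succ, Nat.sub_add_cancel hm]
  simp only [omega1, eval_finsetSum, eval_add, eval_sub, eval_mul, eval_pow, eval_X, eval_C]
  ring

theorem eval_omega2 {m : ℕ} (hm : 1 ≤ m) (β γ : ℂ) (w : ℕ → ℂ) (x : ℝ) (hx : 0 < x) :
    (omega2 m β γ w).eval x = x ^ (m - 1) * (x - ‖β‖ + sigma2 m γ w x) := by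
  have hs : x ^ (m - 1) * sigma2 m γ w x = x ^ (m - 1) * ‖γ‖
      + ∑ j ∈ Finset.range (m - 1), (‖w (2 * j + 1)‖ + ‖w (2 * j)‖) * x ^ j := by
    rw [sigma2, mul_add, Finset.mul_sum]
    congr 1
    refine Finset.sum_congr rfl fun k hk => ?_
    have hk := Finset.mem_range.mp hk
    rw [show x ^ (m - 1) = x ^ k * x ^ (m - 1 - k) by rw [← pow_add]; congr 1; omega]
    field_simp
  rw [mul_add, hs, mul_sub, ← pow_succ, Nat.sub_add_cancel hm]
  simp only [omega2, eval_finsetSum, eval_add, eval_sub, eval_mul, eval_pow, eval_X, eval_C]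
  ring

/-! ### The polynomial of even degree -/

theorem degree_sum_C_mul_X_pow_lt (ℓ : ℕ) (b : ℕ → ℂ) :
    (∑ j ∈ Finset.range ℓ, C (b j) * X ^ j).degree < (ℓ : WithBot ℕ) := by
  refine (degree_sum_le _ _).trans_lt ((Finset.sup_lt_iff (WithBot.bot_lt_coe ℓ)).mpr ?_)
  intro j hj
  exact (degree_C_mul_X_pow_le _ _).trans_lt (Nat.cast_lt.mpr (Finset.mem_range.mp hj))

theorem monicPoly_monic (ℓ : ℕ) (b : ℕ → ℂ) : (monicPoly ℓ b).Monic :=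
  monic_X_pow_add (degree_sum_C_mul_X_pow_lt ℓ b)

theorem natDegree_monicPoly (ℓ : ℕ) (b : ℕ → ℂ) : (monicPoly ℓ b).natDegree = ℓ := by
  refine natDegree_eq_of_degree_eq_some ?_
  rw [monicPoly, degree_add_eq_left_of_degree_lt, degree_X_pow]
  rw [degree_X_pow]
  exact degree_sum_C_mul_X_pow_lt ℓ b

theorem coeff_monicPoly {ℓ j : ℕ} (hj : j < ℓ) (b : ℕ → ℂ) : (monicPoly ℓ b).coeff j = b j := by
  simp [monicPoly, coeff_X_pow, hj.ne, hj]

theorem exists_evenCoeff_poly (ℓ : ℕ) (b : ℕ → ℂ) : ∃ q : ℂ[X], q.Monic ∧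
    q.natDegree = 2 * halfDeg ℓ ∧ (∀ j < 2 * halfDeg ℓ, q.coeff j = evenCoeff ℓ b j) ∧
    (q.roots = (monicPoly ℓ b).roots ∨ q.roots = 0 ::ₘ (monicPoly ℓ b).roots) := by
  by_cases hℓ : Even ℓ
  · have h2 : 2 * halfDeg ℓ = ℓ := by
      obtain ⟨k, rfl⟩ := hℓ
      unfold halfDeg; omega
    refine ⟨monicPoly ℓ b, monicPoly_monic ℓ b, by rw [natDegree_monicPoly, h2], fun j hj => ?_,
      Or.inl rfl⟩
    rw [coeff_monicPoly (h2 ▸ hj), evenCoeff, if_pos hℓ]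
  · have h2 : 2 * halfDeg ℓ = ℓ + 1 := by
      obtain ⟨k, rfl⟩ := Nat.not_even_iff_odd.mp hℓ
      unfold halfDeg; omega
    have hne := (monicPoly_monic ℓ b).ne_zero
    refine ⟨X * monicPoly ℓ b, monic_X.mul (monicPoly_monic ℓ b), ?_, fun j hj => ?_, Or.inr ?_⟩
    · rw [natDegree_X_mul hne, natDegree_monicPoly, h2]
    · rw [evenCoeff, if_neg hℓ]
      cases j with
      | zero => simp
      | succ j => rw [coeff_X_mul, coeff_monicPoly (by omega)]; simp
    · rw [roots_mul (mul_ne_zero X_ne_zero hne), roots_X, Multiset.singleton_add]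

/-- Needed because `q.coeff` and `evenCoeff ℓ b` are only known to agree below `n`. -/
theorem blockA_congr {n : ℕ} {a a' : ℕ → ℂ} (h : ∀ j < n, a j = a' j) {j : ℕ}
    (hj : 2 * j + 1 < n) : blockA n a j = blockA n a' j := by
  simp only [blockA, h (2 * j) (by omega), h (2 * j + 1) hj, h (n - 1) (by omega),
    h (2 * j - 1) (by omega)]

/-! ### Interaction of the separation conditions -/

section Intervals

variable {L L' : Multiset ℂ} {α β : ℂ} {ψ ρ₁ ρ₂ : ℝ → ℝ} {χ₁ χ₂ : ℝ[X]} {k₁ k₂ : ℕ}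
  {t₁ t₂ u₁ u₂ : ℝ}

/-- Here `ψ x` is the radius of the disc about `0`, namely `x ^ 2` or `x`. Both separation
conditions hold on the whole intersection, so `DiscSplit.exists_pair` applies at either end. In the
right-hand splitting the pair has squared moduli at least `ψ (min t₂ u₂)`, which lets the bound from
the left end be transferred. -/
theorem exists_pair_of_max_le_min (hsplit : ∀ x, 0 < x → DiscSplit L α β ![ψ x, ρ₁ x, ρ₂ x])
    (hL : L = L' ∨ L = 0 ::ₘ L') (hψ0 : ∀ x, 0 < x → 0 < ψ x)
    (hψ : ∀ x, 1 ≤ x → x ≤ ψ x) (hψm : ∀ x y, 0 < x → x ≤ y → ψ x ≤ ψ y)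
    (hρ₁ : ∀ x, 0 < x → 0 ≤ ρ₁ x) (hρ₂ : ∀ x, 0 < x → 0 ≤ ρ₂ x)
    (hχ₁ : ∀ x, 0 < x → χ₁.eval x = x ^ k₁ * (ψ x - ‖α‖ + ρ₁ x))
    (hχ₂ : ∀ x, 0 < x → χ₂.eval x = x ^ k₂ * (ψ x - ‖β‖ + ρ₂ x))
    (ht : HasPosRoots χ₁ t₁ t₂) (hu : HasPosRoots χ₂ u₁ u₂) (hle : max t₁ u₁ ≤ min t₂ u₂) :
    ∃ (Z : Multiset ℂ) (y z : ℂ), L' = Z + {y, z} ∧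
      (∀ ζ ∈ Z, ‖ζ‖ ^ 2 ≤ ψ (max t₁ u₁)) ∧
      y ^ 2 ∈ Metric.closedBall α (ρ₁ (min t₂ u₂)) ∪ Metric.closedBall β (ρ₂ (min t₂ u₂)) ∧
      z ^ 2 ∈ Metric.closedBall α (ρ₁ (min t₂ u₂)) ∪ Metric.closedBall β (ρ₂ (min t₂ u₂)) ∧
      (ρ₁ (min t₂ u₂) + ρ₂ (min t₂ u₂) < ‖α - β‖ →
        y ^ 2 ∈ Metric.closedBall α (ρ₁ (min t₂ u₂)) ∧
        z ^ 2 ∈ Metric.closedBall β (ρ₂ (min t₂ u₂))) := by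
  have hpos : 0 < max t₁ u₁ := ht.pos.trans_le (le_max_left _ _)
  have hA : ∀ x ∈ Set.Icc (max t₁ u₁) (min t₂ u₂), ψ x + ρ₁ x ≤ ‖α‖ ∧ ψ x + ρ₂ x ≤ ‖β‖ :=
    fun x hx => ⟨ht.add_le hχ₁ hψ hρ₁
        ⟨(le_max_left _ _).trans hx.1, hx.2.trans (min_le_left _ _)⟩,
      hu.add_le hχ₂ hψ hρ₂ ⟨(le_max_right _ _).trans hx.1, hx.2.trans (min_le_right _ _)⟩⟩
  have hpair := fun x (hx : x ∈ Set.Icc (max t₁ u₁) (min t₂ u₂)) =>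
    have hx0 := hpos.trans_le hx.1
    (hsplit x hx0).exists_pair hL (hψ0 x hx0) (hρ₁ x hx0) (hρ₂ x hx0) (hA x hx).1 (hA x hx).2
  obtain ⟨Z, y, z, hZL, hZ, -⟩ := hpair _ ⟨le_rfl, hle⟩
  obtain ⟨Z', y', z', hZL', hZ', hy', hz', hyz'⟩ := hpair _ ⟨hle, le_rfl⟩
  have hlow : ∀ x : ℂ, x ^ 2 ∈ Metric.closedBall α (ρ₁ (min t₂ u₂)) ∪
      Metric.closedBall β (ρ₂ (min t₂ u₂)) → ψ (min t₂ u₂) ≤ ‖x‖ ^ 2 := by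
    obtain ⟨h1, h2⟩ := hA _ ⟨hle, le_rfl⟩
    rintro x (hx | hx)
    all_goals
      have := sub_le_norm_of_mem_closedBall hx
      rw [norm_pow] at this
      linarith
  exact ⟨Z', y', z', hZL', norm_sq_le_of_splittings (hψm _ _ hpos hle) hZL hZ hZL' hZ'
    (hlow _ hy') (hlow _ hz'), hy', hz', hyz'⟩

theorem exists_left_of_hasPosRoots
    (hsplit : ∀ x, 0 < x → DiscSplit L α β ![ψ x, ρ₁ x, ρ₂ x])
    (hL : L = L' ∨ L = 0 ::ₘ L') (hψ0 : ∀ x, 0 < x → 0 < ψ x) (hψ : ∀ x, 1 ≤ x → x ≤ ψ x)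
    (hρ₁ : ∀ x, 0 < x → 0 ≤ ρ₁ x) (hρ₂ : ∀ x, 0 < x → 0 ≤ ρ₂ x)
    (hχ₁ : ∀ x, 0 < x → χ₁.eval x = x ^ k₁ * (ψ x - ‖α‖ + ρ₁ x))
    (ht : HasPosRoots χ₁ t₁ t₂) (hs : ρ₁ t₂ + ρ₂ t₂ < ‖α - β‖) :
    ∃ (Z : Multiset ℂ) (y : ℂ), L' = Z + {y} ∧
      (∀ ζ ∈ Z, ζ ^ 2 ∈ Metric.closedBall 0 (ψ t₂) ∪ Metric.closedBall β (ρ₂ t₂)) ∧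
      y ^ 2 ∈ Metric.closedBall α (ρ₁ t₂) := by
  have h0 : 0 < t₂ := ht.pos.trans_le ht.1
  exact (hsplit _ h0).exists_left hL (hψ0 _ h0) (hρ₁ _ h0) (hρ₂ _ h0)
    (ht.add_le hχ₁ hψ hρ₁ ⟨ht.1, le_rfl⟩) hs

theorem exists_right_of_hasPosRoots
    (hsplit : ∀ x, 0 < x → DiscSplit L α β ![ψ x, ρ₁ x, ρ₂ x])
    (hL : L = L' ∨ L = 0 ::ₘ L') (hψ0 : ∀ x, 0 < x → 0 < ψ x) (hψ : ∀ x, 1 ≤ x → x ≤ ψ x)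
    (hρ₁ : ∀ x, 0 < x → 0 ≤ ρ₁ x) (hρ₂ : ∀ x, 0 < x → 0 ≤ ρ₂ x)
    (hχ₂ : ∀ x, 0 < x → χ₂.eval x = x ^ k₂ * (ψ x - ‖β‖ + ρ₂ x))
    (hu : HasPosRoots χ₂ u₁ u₂) (hs : ρ₁ u₂ + ρ₂ u₂ < ‖α - β‖) :
    ∃ (Z : Multiset ℂ) (y : ℂ), L' = Z + {y} ∧
      (∀ ζ ∈ Z, ζ ^ 2 ∈ Metric.closedBall 0 (ψ u₂) ∪ Metric.closedBall α (ρ₁ u₂)) ∧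
      y ^ 2 ∈ Metric.closedBall β (ρ₂ u₂) := by
  have h0 : 0 < u₂ := hu.pos.trans_le hu.1
  exact (hsplit _ h0).exists_right hL (hψ0 _ h0) (hρ₁ _ h0) (hρ₂ _ h0)
    (hu.add_le hχ₂ hψ hρ₂ ⟨hu.1, le_rfl⟩) hs

theorem max_le_min_of_inter_nonempty
    (h : (posRootInterval χ₁ ∩ posRootInterval χ₂).Nonempty)
    (ht : HasPosRoots χ₁ t₁ t₂) (hu : HasPosRoots χ₂ u₁ u₂) : max t₁ u₁ ≤ min t₂ u₂ := by
  obtain ⟨x, ⟨s, t, hst, hx⟩, ⟨s', t', hst', hx'⟩⟩ := h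
  obtain ⟨rfl, rfl⟩ := hst.unique ht
  obtain ⟨rfl, rfl⟩ := hst'.unique hu
  exact (max_le hx.1 hx'.1).trans (le_min hx.2 hx'.2)

end Intervals

/-- A splitting of the roots of `p` leaves an annulus free of roots. -/
theorem not_isRoot_of_splitting {p : ℂ[X]} (hp : p ≠ 0) {Z : Multiset ℂ} {y z α β : ℂ}
    {M r₁ r₂ : ℝ} (h : p.roots = Z + {y, z}) (hZ : ∀ ζ ∈ Z, ‖ζ‖ ≤ M)
    (hy : y ^ 2 ∈ Metric.closedBall α r₁ ∪ Metric.closedBall β r₂)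
    (hz : z ^ 2 ∈ Metric.closedBall α r₁ ∪ Metric.closedBall β r₂) (ζ : ℂ) (hζ : p.IsRoot ζ) :
    ¬ (M < ‖ζ‖ ∧ ‖ζ‖ < Real.sqrt (min (‖α‖ - r₁) (‖β‖ - r₂))) := by
  rintro ⟨h1, h2⟩
  rw [Real.lt_sqrt (norm_nonneg ζ), lt_min_iff, ← norm_pow] at h2
  -- A zero in the annulus is too large for `Z` and too small for either disc.
  have hlow : ∀ x : ℂ, x ^ 2 ∈ Metric.closedBall α r₁ ∪ Metric.closedBall β r₂ → x ≠ ζ := by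
    rintro x (hx | hx) rfl
    all_goals
      have := sub_le_norm_of_mem_closedBall hx
      linarith [h2.1, h2.2]
  have hmem : ζ ∈ Z + {y, z} := h ▸ (mem_roots hp).mpr hζ
  rw [Multiset.mem_add, Multiset.insert_eq_cons, Multiset.mem_cons, Multiset.mem_singleton] at hmem
  rcases hmem with hmem | rfl | rfl
  · exact absurd (hZ ζ hmem) (not_le.mpr h1)
  · exact hlow _ hy rfl
  · exact hlow _ hz rfl

end PelletSquared

end

/-! ### Assembly of the four cases -/

theorem theorem4p1
    (ℓ : ℕ) (hℓ : 3 ≤ ℓ) (b : ℕ → ℂ)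
    (p : Polynomial ℂ) (hp : p = PelletSquared.monicPoly ℓ b)
    (m n : ℕ) (hm : m = PelletSquared.halfDeg ℓ) (hn : n = 2 * m)
    (A : ℕ → Matrix (Fin 2) (Fin 2) ℂ)
    (hA : A = PelletSquared.blockA n (PelletSquared.evenCoeff ℓ b))
    (S : Matrix (Fin 2) (Fin 2) ℂ) (hS : IsUnit S.det)
    (α β γ : ℂ) (hαβγ : S⁻¹ * A (m - 1) * S = !![α, γ; 0, β])
    (v w : ℕ → ℂ)
    (hvw : ∀ j < m - 1,
      !![v (2 * j), w (2 * j); v (2 * j + 1), w (2 * j + 1)] = S⁻¹ * A j * S)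
    (ρ₁ ρ₂ σ₁ σ₂ : ℝ → ℝ)
    (hρ₁ : ρ₁ = PelletSquared.rho1 n v) (hρ₂ : ρ₂ = PelletSquared.rho2 n γ w)
    (hσ₁ : σ₁ = PelletSquared.sigma1 m v) (hσ₂ : σ₂ = PelletSquared.sigma2 m γ w)
    (χ₁ χ₂ ω₁ ω₂ : Polynomial ℝ)
    (hχ₁ : χ₁ = PelletSquared.chi1 n α v) (hχ₂ : χ₂ = PelletSquared.chi2 n β γ w)
    (hω₁ : ω₁ = PelletSquared.omega1 m α v) (hω₂ : ω₂ = PelletSquared.omega2 m β γ w)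
    (O₁ O₂ O₃ O₁' O₂' O₃' : ℝ → Set ℂ)
    (hO₁ : O₁ = fun x => Metric.closedBall 0 (x ^ 2))
    (hO₂ : O₂ = fun x => Metric.closedBall α (ρ₁ x))
    (hO₃ : O₃ = fun x => Metric.closedBall β (ρ₂ x))
    (hO₁' : O₁' = fun x => Metric.closedBall 0 x)
    (hO₂' : O₂' = fun x => Metric.closedBall α (σ₁ x))
    (hO₃' : O₃' = fun x => Metric.closedBall β (σ₂ x))
    (I₁ I₂ J₁ J₂ : Set ℝ)
    (hI₁ : I₁ = PelletSquared.posRootInterval χ₁)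
    (hI₂ : I₂ = PelletSquared.posRootInterval χ₂)
    (hJ₁ : J₁ = PelletSquared.posRootInterval ω₁)
    (hJ₂ : J₂ = PelletSquared.posRootInterval ω₂) :
    -- diagonal scaling, the two intervals meet
    ((I₁ ∩ I₂).Nonempty → ∀ t₁ t₂ u₁ u₂ μ₁ μ₂ : ℝ,
      PelletSquared.HasPosRoots χ₁ t₁ t₂ → PelletSquared.HasPosRoots χ₂ u₁ u₂ →
      μ₁ = max t₁ u₁ → μ₂ = min t₂ u₂ →
      (∃ (Z : Multiset ℂ) (y z : ℂ), p.roots = Z + {y, z} ∧ Z.card = ℓ - 2 ∧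
        (∀ ζ ∈ Z, ζ ∈ Metric.closedBall (0 : ℂ) μ₁) ∧
        y ^ 2 ∈ O₂ μ₂ ∪ O₃ μ₂ ∧ z ^ 2 ∈ O₂ μ₂ ∪ O₃ μ₂ ∧
        (ρ₁ μ₂ + ρ₂ μ₂ < ‖α - β‖ → y ^ 2 ∈ O₂ μ₂ ∧ z ^ 2 ∈ O₃ μ₂)) ∧
      (∀ ζ : ℂ, p.IsRoot ζ →
        ¬ (μ₁ < ‖ζ‖ ∧ ‖ζ‖ < Real.sqrt (min (‖α‖ - ρ₁ μ₂) (‖β‖ - ρ₂ μ₂))))) ∧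
    -- diagonal scaling, the two intervals are disjoint
    (I₁ ∩ I₂ = ∅ →
      (∀ t₁ t₂ : ℝ, PelletSquared.HasPosRoots χ₁ t₁ t₂ → ρ₁ t₂ + ρ₂ t₂ < ‖α - β‖ →
        ∃ (Z : Multiset ℂ) (y : ℂ), p.roots = Z + {y} ∧ Z.card = ℓ - 1 ∧
          (∀ ζ ∈ Z, ζ ^ 2 ∈ O₁ t₂ ∪ O₃ t₂) ∧ y ^ 2 ∈ O₂ t₂) ∧
      (∀ u₁ u₂ : ℝ, PelletSquared.HasPosRoots χ₂ u₁ u₂ → ρ₁ u₂ + ρ₂ u₂ < ‖α - β‖ →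
        ∃ (Z : Multiset ℂ) (y : ℂ), p.roots = Z + {y} ∧ Z.card = ℓ - 1 ∧
          (∀ ζ ∈ Z, ζ ^ 2 ∈ O₁ u₂ ∪ O₂ u₂) ∧ y ^ 2 ∈ O₃ u₂)) ∧
    -- block-diagonal scaling, the two intervals meet
    ((J₁ ∩ J₂).Nonempty → ∀ t₁ t₂ u₁ u₂ μ₁ μ₂ : ℝ,
      PelletSquared.HasPosRoots ω₁ t₁ t₂ → PelletSquared.HasPosRoots ω₂ u₁ u₂ →
      μ₁ = max t₁ u₁ → μ₂ = min t₂ u₂ →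
      (∃ (Z : Multiset ℂ) (y z : ℂ), p.roots = Z + {y, z} ∧ Z.card = ℓ - 2 ∧
        (∀ ζ ∈ Z, ζ ∈ Metric.closedBall (0 : ℂ) (Real.sqrt μ₁)) ∧
        y ^ 2 ∈ O₂' μ₂ ∪ O₃' μ₂ ∧ z ^ 2 ∈ O₂' μ₂ ∪ O₃' μ₂ ∧
        (σ₁ μ₂ + σ₂ μ₂ < ‖α - β‖ → y ^ 2 ∈ O₂' μ₂ ∧ z ^ 2 ∈ O₃' μ₂)) ∧
      (∀ ζ : ℂ, p.IsRoot ζ →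
        ¬ (Real.sqrt μ₁ < ‖ζ‖ ∧
          ‖ζ‖ < Real.sqrt (min (‖α‖ - σ₁ μ₂) (‖β‖ - σ₂ μ₂))))) ∧
    -- block-diagonal scaling, the two intervals are disjoint
    (I₁ ∩ I₂ = ∅ ∨ J₁ ∩ J₂ = ∅ →
      (∀ t₁ t₂ : ℝ, PelletSquared.HasPosRoots ω₁ t₁ t₂ → σ₁ t₂ + σ₂ t₂ < ‖α - β‖ →
        ∃ (Z : Multiset ℂ) (y : ℂ), p.roots = Z + {y} ∧ Z.card = ℓ - 1 ∧
          (∀ ζ ∈ Z, ζ ^ 2 ∈ O₁' t₂ ∪ O₃' t₂) ∧ y ^ 2 ∈ O₂' t₂) ∧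
      (∀ u₁ u₂ : ℝ, PelletSquared.HasPosRoots ω₂ u₁ u₂ → σ₁ u₂ + σ₂ u₂ < ‖α - β‖ →
        ∃ (Z : Multiset ℂ) (y : ℂ), p.roots = Z + {y} ∧ Z.card = ℓ - 1 ∧
          (∀ ζ ∈ Z, ζ ^ 2 ∈ O₁' u₂ ∪ O₂' u₂) ∧ y ^ 2 ∈ O₃' u₂)) := by
  subst hp hA hρ₁ hρ₂ hσ₁ hσ₂ hχ₁ hχ₂ hω₁ hω₂ hO₁ hO₂ hO₃ hO₁' hO₂' hO₃' hI₁ hI₂ hJ₁ hJ₂ hn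
  have hm2 : 2 ≤ m := by rw [hm, PelletSquared.halfDeg]; omega
  obtain ⟨q, hq, hqd, hqc, hL⟩ := PelletSquared.exists_evenCoeff_poly ℓ b
  rw [← hm] at hqd hqc
  have hp0 := (PelletSquared.monicPoly_monic ℓ b).ne_zero
  have hcard : (PelletSquared.monicPoly ℓ b).roots.card = ℓ := by
    rw [← (IsAlgClosed.splits _).natDegree_eq_card_roots, PelletSquared.natDegree_monicPoly]
  have hcard2 : ∀ {Z : Multiset ℂ} {y z : ℂ},
      (PelletSquared.monicPoly ℓ b).roots = Z + {y, z} → Z.card = ℓ - 2 := by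
    intro Z y z h
    have := congrArg Multiset.card h
    rw [hcard, Multiset.card_add, Multiset.card_pair] at this
    omega
  have hcard1 : ∀ {Z : Multiset ℂ} {y : ℂ},
      (PelletSquared.monicPoly ℓ b).roots = Z + {y} → Z.card = ℓ - 1 := by
    intro Z y h
    have := congrArg Multiset.card h
    rw [hcard, Multiset.card_add, Multiset.card_singleton] at this
    omega
  have hlast : S⁻¹ * PelletSquared.blockA (2 * m) q.coeff (m - 1) * S = !![α, γ; 0, β] := by
    rw [PelletSquared.blockA_congr hqc (by omega), hαβγ]
  have hvw' : ∀ j < m - 1, !![v (2 * j), w (2 * j); v (2 * j + 1), w (2 * j + 1)]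
      = S⁻¹ * PelletSquared.blockA (2 * m) q.coeff j * S := fun j hj => by
    rw [PelletSquared.blockA_congr hqc (by omega), hvw j hj]
  have hρ := fun x => PelletSquared.discSplit_rho hm2 hq hqd hS hlast hvw' (x := x)
  have hσ := fun x => PelletSquared.discSplit_sigma hm2 hq hqd hS hlast hvw' (x := x)
  have hρ₁ := PelletSquared.rho1_nonneg (2 * m) v
  have hρ₂ := PelletSquared.rho2_nonneg (2 * m) γ w
  have hσ₁ := PelletSquared.sigma1_nonneg m v
  have hσ₂ := PelletSquared.sigma2_nonneg m γ w
  have hχ₁ := PelletSquared.eval_chi1 (n := 2 * m) (by omega) α v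
  have hχ₂ := PelletSquared.eval_chi2 (n := 2 * m) (by omega) β γ w
  have hω₁ := PelletSquared.eval_omega1 (m := m) (by omega) α v
  have hω₂ := PelletSquared.eval_omega2 (m := m) (by omega) β γ w
  have hsq0 : ∀ x : ℝ, 0 < x → 0 < x ^ 2 := fun x hx => by positivity
  have hsq : ∀ x : ℝ, 1 ≤ x → x ≤ x ^ 2 := fun x hx => by nlinarith
  have hsqm : ∀ x y : ℝ, 0 < x → x ≤ y → x ^ 2 ≤ y ^ 2 := fun x y hx hxy => by gcongr
  refine ⟨?_, ?_, ?_, ?_⟩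
  · rintro hI t₁ t₂ u₁ u₂ μ₁ μ₂ ht hu rfl rfl
    obtain ⟨Z, y, z, hZ, hb, hy, hz, hyz⟩ := PelletSquared.exists_pair_of_max_le_min
      (ψ := fun x => x ^ 2) hρ hL hsq0 hsq hsqm hρ₁ hρ₂ hχ₁ hχ₂ ht hu
      (PelletSquared.max_le_min_of_inter_nonempty hI ht hu)
    have hb' : ∀ ζ ∈ Z, ‖ζ‖ ≤ max t₁ u₁ := fun ζ hζ =>
      (sq_le_sq₀ (norm_nonneg ζ) (ht.pos.le.trans (le_max_left _ _))).mp (hb ζ hζ)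
    exact ⟨⟨Z, y, z, hZ, hcard2 hZ, fun ζ hζ => mem_closedBall_zero_iff.mpr (hb' ζ hζ),
      hy, hz, hyz⟩, PelletSquared.not_isRoot_of_splitting hp0 hZ hb' hy hz⟩
  · intro _
    refine ⟨fun t₁ t₂ ht hs => ?_, fun u₁ u₂ hu hs => ?_⟩
    · obtain ⟨Z, y, hZ, hb, hy⟩ := PelletSquared.exists_left_of_hasPosRoots
        (ψ := fun x => x ^ 2) hρ hL hsq0 hsq hρ₁ hρ₂ hχ₁ ht hs
      exact ⟨Z, y, hZ, hcard1 hZ, hb, hy⟩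
    · obtain ⟨Z, y, hZ, hb, hy⟩ := PelletSquared.exists_right_of_hasPosRoots
        (ψ := fun x => x ^ 2) hρ hL hsq0 hsq hρ₁ hρ₂ hχ₂ hu hs
      exact ⟨Z, y, hZ, hcard1 hZ, hb, hy⟩
  · rintro hJ t₁ t₂ u₁ u₂ μ₁ μ₂ ht hu rfl rfl
    obtain ⟨Z, y, z, hZ, hb, hy, hz, hyz⟩ := PelletSquared.exists_pair_of_max_le_min
      (ψ := fun x => x) hσ hL (fun _ => id) (fun x _ => le_rfl) (fun _ _ _ => id)
      hσ₁ hσ₂ hω₁ hω₂ ht hu (PelletSquared.max_le_min_of_inter_nonempty hJ ht hu)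
    have hb' : ∀ ζ ∈ Z, ‖ζ‖ ≤ Real.sqrt (max t₁ u₁) := fun ζ hζ => Real.le_sqrt_of_sq_le (hb ζ hζ)
    exact ⟨⟨Z, y, z, hZ, hcard2 hZ, fun ζ hζ => mem_closedBall_zero_iff.mpr (hb' ζ hζ),
      hy, hz, hyz⟩, PelletSquared.not_isRoot_of_splitting hp0 hZ hb' hy hz⟩
  · intro _
    refine ⟨fun t₁ t₂ ht hs => ?_, fun u₁ u₂ hu hs => ?_⟩
    · obtain ⟨Z, y, hZ, hb, hy⟩ := PelletSquared.exists_left_of_hasPosRoots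
        (ψ := fun x => x) hσ hL (fun _ => id) (fun x _ => le_rfl) hσ₁ hσ₂ hω₁ ht hs
      exact ⟨Z, y, hZ, hcard1 hZ, hb, hy⟩
    · obtain ⟨Z, y, hZ, hb, hy⟩ := PelletSquared.exists_right_of_hasPosRoots
        (ψ := fun x => x) hσ hL (fun _ => id) (fun x _ => le_rfl) hσ₁ hσ₂ hω₂ hu hs
      exact ⟨Z, y, hZ, hcard1 hZ, hb, hy⟩
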